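/- **Setting.** Let $K$ be a field that is complete for a discrete valuation $\mathrm{val}:K\to\mathbb R\cup\{\infty\}$, let $n\ge 1$ and $r\in\mathbb Q^n$. Let $K\{\mathbf X;r\}$ be the ring of Laurent series $\sum_{u\in\mathbb Z^n}a_u\mathbf X^u$ with $a_u\in K$ and $\mathrm{val}(a_u)-r\cdot u\to+\infty$ as $|u|\to\infty$, and put $\mathrm{val}_r(\sum_u a_u\mathbf X^u)=\min_u(\mathrm{val}(a_u)-r\cdot u)$. Let $T=\{\mathbf X^u:u\in\mathbb Z^n\}$ and let $(T_i)_{i\in I}$ be a conic decomposition of $T$: a finite family of finitely generated submonoids with union $T$, each of which generates $T$ as a group and has $1$ as its only invertible element. Fix a generalized monomial order for it: a total order on $T$ such that $1\le t$ for all $t\in T$, and such that for all $i\in I$, $\rho\in T$ and $s,t\in T_i$, $\rho<s$ implies $\rho t<st$. For a nonzero Laurent polynomial $p$, $\mathrm{lm}(p)$ is its largest monomial and $\mathrm{lc}(p)$ the coefficient of that monomial; $T_i(p)=\{t\in T:\mathrm{lm}(tp)\in T_i\}$; $\mathrm{lm}_i(p)=\mathrm{lm}(tp)t^{-1}$ for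 any $t\in T_i(p)$, and $\mathrm{lc}_i(p)$ is the coefficient of $\mathrm{lm}_i(p)$ in $p$. For $0\ne f\in K\{\mathbf X;r\}$ these notions are those of the Laurent polynomial $\mathrm{in}_r(f)$, the sum of the terms of $f$ of valuation $\mathrm{val}_r(f)$; put $\mathrm{lt}(f)=\mathrm{lc}(f)\mathrm{lm}(f)$ and $\mathrm{lt}_i(f)=\mathrm{lc}_i(f)\mathrm{lm}_i(f)$. A Gröbner basis of an ideal $J$ is a finite set $G\subset J\setminus\{0\}$ with $\{\mathrm{lm}(f):0\ne f\in J\}=\bigcup_{g\in G,\,i\in I}T_i(g)\,\mathrm{lm}_i(g)$. **Division of $f$ by a finite set $H\subset K\{\mathbf X;r\}\setminus\{0\}$.** Start with $q_h=0$ $(h\in H)$ and $s=0$. As long as $f\ne0$: if there are $i\in I$, $h\in H$ with $\mathrm{lm}\big(\tfrac{\mathrm{lm}(f)}{\mathrm{lm}_i(h)}h\big)=\mathrm{lm}(f)$, choose such a pair, put $t=\mathrm{lt}(f)/\mathrm{lt}_i(h)$, and replace $f$ by $f-th$ and $q_h$ by $q_h+t$; otherwise replace $s$ by $s+\mathrm{lt}(f)$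 and $f$ by $f-\mathrm{lt}(f)$. This takes at most countably many steps; the output is the limit for $\mathrm{val}_r$ of the $q_h$ and of $s$ (the remainder), the successive $f$ tending to $0$. **Buchberger's algorithm.** For $v\in \mathrm{lm}_i(f)T_i(f)\cap\mathrm{lm}_i(g)T_i(g)$ let $S(i,f,g,v)=\mathrm{lc}_i(g)\frac{v}{\mathrm{lm}_i(f)}f-\mathrm{lc}_i(f)\frac{v}{\mathrm{lm}_i(g)}g$. On input of nonzero $h_1,\dots,h_m\in K\{\mathbf X;r\}$, start with $H=\{h_1,\dots,h_m\}$ and $B=\{(h_j,h_k):j<k\}$. While $B\neq\emptyset$, remove a pair $(f,g)$ from $B$; for each $i\in I$, choose a finite set $U$ of generators of the $T_i$-module $\mathrm{lm}_i(f)T_i(f)\cap\mathrm{lm}_i(g)T_i(g)$; for each $v\in U$, let $s$ be the remainder of the division of $S(i,f,g,v)$ by $H$, and if $s\ne0$, add the pairs $(h,s)$, $h\in H$, to $B$ and then $s$ to $H$. When $B=\emptyset$, return $H$. **Proposition.** Buchberger's algorithm is correct and terminates, whatever choices are made in it (the pairs, the order of the loops, the sets of generators, the reductions in the divisions): it can always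 be carried out (the sets $U$ exist and every division it calls converges), every run consists of finitely many steps, each of which is at most one call of the division, so that the division is called only finitely many times, and the set $H$ that it returns is a Gröbner basis of the ideal $J=(h_1,\dots,h_m)$. -/

import Mathlib

namespace LaurentGB

open Filter Topology

/-! ## The base field -/

/-- A field with a discrete valuation `val : K → ℝ ∪ {∞}` for which it is complete. -/
class CompleteDVField (K : Type*) [Field K] where
  /-- the valuation -/
  val : AddValuation K (WithTop ℝ)
  /-- `val` is discrete: there is a uniformizer, i.e. an element of least positive
  finite valuation. -/
  exists_uniformizer : ∃ π : K, π ≠ 0 ∧ 0 < val π ∧ ∀ x : K, 0 < val x → val π ≤ val x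
  /-- every Cauchy sequence converges -/
  complete : ∀ x : ℕ → K,
    (∀ N : ℝ, ∃ k₀, ∀ k ≥ k₀, ∀ l ≥ k₀, (N : WithTop ℝ) ≤ val (x k - x l)) →
    ∃ y : K, ∀ N : ℝ, ∃ k₀, ∀ k ≥ k₀, (N : WithTop ℝ) ≤ val (x k - y)

section Norm

variable {K : Type*} [Field K] [CompleteDVField K]

/-- The valuation of `K`. -/
noncomputable def val (x : K) : WithTop ℝ := CompleteDVField.val x

lemma val_zero : val (0 : K) = ⊤ := (CompleteDVField.val (K := K)).map_zero

lemma val_eq_top_iff {x : K} : val x = ⊤ ↔ x = 0 :=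
  (CompleteDVField.val (K := K)).top_iff

lemma val_mul (x y : K) : val (x * y) = val x + val y :=
  (CompleteDVField.val (K := K)).map_mul x y

lemma val_one : val (1 : K) = 0 := (CompleteDVField.val (K := K)).map_one

lemma val_add (x y : K) : min (val x) (val y) ≤ val (x + y) :=
  (CompleteDVField.val (K := K)).map_add x y

open Classical in
/-- The absolute value `exp (- val x)`. -/
noncomputable def absVal (x : K) : ℝ := if x = 0 then 0 else Real.exp (-(val x).untopD 0)

lemma le_val_iff (N : ℝ) (x : K) : (N : WithTop ℝ) ≤ val x ↔ absVal x ≤ Real.exp (-N) := by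
  by_cases hx : x = 0
  · simp [hx, val_zero, absVal, Real.exp_nonneg]
  · obtain ⟨a, ha⟩ := WithTop.ne_top_iff_exists.mp (mt val_eq_top_iff.mp hx)
    simp [absVal, hx, ← ha]

lemma absVal_nonneg (x : K) : 0 ≤ absVal x := by
  unfold absVal; split_ifs <;> positivity

lemma absVal_eq_zero {x : K} : absVal x = 0 ↔ x = 0 := by
  unfold absVal; split_ifs with h <;> simp [h, Real.exp_ne_zero]

lemma absVal_mul (x y : K) : absVal (x * y) = absVal x * absVal y := by
  by_cases hx : x = 0
  · simp [hx, absVal]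
  by_cases hy : y = 0
  · simp [hy, absVal]
  obtain ⟨a, ha⟩ := WithTop.ne_top_iff_exists.mp (mt val_eq_top_iff.mp hx)
  obtain ⟨b, hb⟩ := WithTop.ne_top_iff_exists.mp (mt val_eq_top_iff.mp hy)
  have : val (x * y) = ((a + b : ℝ) : WithTop ℝ) := by rw [val_mul, ← ha, ← hb]; rfl
  simp only [absVal, hx, hy, mul_eq_zero, or_self, if_false, this, ← ha, ← hb,
    WithTop.untopD_coe, ← Real.exp_add]
  congr 1; ring

lemma absVal_add_le_max (x y : K) : absVal (x + y) ≤ max (absVal x) (absVal y) := by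
  rcases (le_max_iff.mpr (Or.inl (absVal_nonneg x)) :
    0 ≤ max (absVal x) (absVal y)).eq_or_lt with h | h
  · have hx : x = 0 := absVal_eq_zero.mp
      (le_antisymm (h ▸ le_max_left _ _) (absVal_nonneg x))
    have hy : y = 0 := absVal_eq_zero.mp
      (le_antisymm (h ▸ le_max_right _ _) (absVal_nonneg y))
    simp [hx, hy, absVal]
  · have key := fun z : K => le_val_iff (-Real.log (max (absVal x) (absVal y))) z
    simp only [neg_neg, Real.exp_log h] at key
    exact (key _).mp (le_trans (le_min ((key x).mpr (le_max_left _ _))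
      ((key y).mpr (le_max_right _ _))) (val_add x y))

/-- The absolute value as a bundled map. -/
noncomputable def absValue (K : Type*) [Field K] [CompleteDVField K] : AbsoluteValue K ℝ where
  toFun := absVal
  map_mul' := absVal_mul
  nonneg' := absVal_nonneg
  eq_zero' _ := absVal_eq_zero
  add_le' x y := (absVal_add_le_max x y).trans
    (max_le_add_of_nonneg (absVal_nonneg x) (absVal_nonneg y))

/-- The norm `‖x‖ = exp (- val x)` on `K`; it is used to sum infinite families in `K`. -/
@[reducible] noncomputable def normedField (K : Type*) [Field K] [CompleteDVField K] :
    NormedField K := (absValue K).toNormedField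

attribute [local instance] normedField

lemma norm_eq_absVal (x : K) : ‖x‖ = absVal x := rfl

lemma le_val_iff_norm (N : ℝ) (x : K) : (N : WithTop ℝ) ≤ val x ↔ ‖x‖ ≤ Real.exp (-N) :=
  le_val_iff N x

lemma isUltrametric (K : Type*) [Field K] [CompleteDVField K] : IsUltrametricDist K :=
  IsUltrametricDist.isUltrametricDist_of_forall_norm_add_le_max_norm absVal_add_le_max

lemma completeSpace (K : Type*) [Field K] [CompleteDVField K] : CompleteSpace K := by
  refine Metric.complete_of_cauchySeq_tendsto fun x hx => ?_
  obtain ⟨y, hy⟩ := CompleteDVField.complete x (by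
    intro N
    obtain ⟨k₀, hk⟩ := Metric.cauchySeq_iff.mp hx (Real.exp (-N)) (Real.exp_pos _)
    refine ⟨k₀, fun k hk' l hl => (le_val_iff_norm N _).mpr ?_⟩
    rw [← dist_eq_norm]
    exact (hk k hk' l hl).le)
  refine ⟨y, Metric.tendsto_atTop.mpr fun ε hε => ?_⟩
  obtain ⟨k₀, hk⟩ := hy (-Real.log (ε / 2))
  refine ⟨k₀, fun k hk' => ?_⟩
  have := (le_val_iff_norm _ _).mp (hk k hk')
  rw [neg_neg, Real.exp_log (by positivity)] at this
  rw [dist_eq_norm]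
  linarith

end Norm

/-! ## Monomials and the algebra `K{X;r}` -/

/-- The group `T` of monomials `X^u`, `u ∈ ℤⁿ`, written additively through the exponents. It
carries no order by default. -/
def Mon (n : ℕ) : Type := Fin n → ℤ

noncomputable instance (n : ℕ) : AddCommGroup (Mon n) := inferInstanceAs (AddCommGroup (Fin n → ℤ))

section Algebra

variable {K : Type*} [Field K] [CompleteDVField K] {n : ℕ}

/-- The scalar product `r · u`. -/
noncomputable def dot (r : Fin n → ℚ) (u : Mon n) : ℝ := ∑ k, (r k : ℝ) * (u k : ℝ)

lemma dot_add (r : Fin n → ℚ) (u v : Mon n) : dot r (u + v) = dot r u + dot r v := by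
  simp only [dot, ← Finset.sum_add_distrib]
  refine Finset.sum_congr rfl fun k _ => ?_
  have : (u + v) k = u k + v k := rfl
  rw [this]; push_cast; ring

lemma dot_zero (r : Fin n → ℚ) : dot r 0 = 0 := by
  have := dot_add r 0 0
  rw [add_zero] at this
  linarith

/-- The valuation `val_r (a X^u) = val a - r · u` of a term. -/
noncomputable def termVal (r : Fin n → ℚ) (a : K) (u : Mon n) : WithTop ℝ :=
  val a + ((-dot r u : ℝ) : WithTop ℝ)

attribute [local instance] normedField

/-- The size `exp (- val_r (a X^u))` of a term. -/
noncomputable def termNorm (r : Fin n → ℚ) (a : K) (u : Mon n) : ℝ := ‖a‖ * Real.exp (dot r u)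

lemma termNorm_nonneg (r : Fin n → ℚ) (a : K) (u : Mon n) : 0 ≤ termNorm r a u := by
  unfold termNorm; positivity

lemma le_termVal_iff (r : Fin n → ℚ) (a : K) (u : Mon n) (N : ℝ) :
    (N : WithTop ℝ) ≤ termVal r a u ↔ termNorm r a u ≤ Real.exp (-N) := by
  have h1 : (N : WithTop ℝ) ≤ termVal r a u ↔ ((N + dot r u : ℝ) : WithTop ℝ) ≤ val a := by
    unfold termVal
    cases hv : val a with
    | top => simp
    | coe x =>
      rw [← WithTop.coe_add, WithTop.coe_le_coe, WithTop.coe_le_coe]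
      constructor <;> intro h <;> linarith
  rw [h1, le_val_iff_norm, termNorm, ← le_div_iff₀ (Real.exp_pos _), ← Real.exp_sub]
  ring_nf

/-- The condition `val (a_u) - r · u → +∞` as `|u| → ∞`. -/
def Converges (r : Fin n → ℚ) (a : Mon n → K) : Prop :=
  ∀ N : ℝ, ∀ᶠ u in cofinite, (N : WithTop ℝ) ≤ termVal r (a u) u

lemma converges_iff (r : Fin n → ℚ) (a : Mon n → K) :
    Converges r a ↔ Tendsto (fun u => termNorm r (a u) u) cofinite (𝓝 0) := by
  constructor
  · intro h
    refine Metric.tendsto_nhds.mpr fun ε hε => ?_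
    filter_upwards [h (-Real.log (ε / 2))] with u hu
    rw [le_termVal_iff, neg_neg, Real.exp_log (by positivity)] at hu
    rw [Real.dist_eq, sub_zero, abs_of_nonneg (termNorm_nonneg _ _ _)]
    linarith
  · intro h N
    filter_upwards [(tendsto_order.mp h).2 _ (Real.exp_pos (-N))] with u hu
    exact (le_termVal_iff _ _ _ _).mpr hu.le

variable (K) in
/-- The Laurent series satisfying the convergence condition, as a group of coefficient families. -/
def convergentSeries (r : Fin n → ℚ) : AddSubgroup (Mon n → K) where
  carrier := {a | Converges r a}
  zero_mem' := by
    have : (fun u : Mon n => termNorm r ((0 : Mon n → K) u) u) = fun _ => 0 := by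
      funext u; simp [termNorm]
    show Converges r _
    rw [converges_iff, this]
    exact tendsto_const_nhds
  add_mem' := by
    intro a b ha hb
    show Converges r _
    have ha' := (converges_iff r a).mp ha
    have hb' := (converges_iff r b).mp hb
    rw [converges_iff]
    refine squeeze_zero (fun u => termNorm_nonneg _ _ _) (fun u => ?_)
      (by simpa using ha'.add hb')
    simp only [termNorm, ← add_mul]
    exact mul_le_mul_of_nonneg_right (norm_add_le _ _) (Real.exp_nonneg _)
  neg_mem' := by
    intro a ha
    show Converges r _
    have ha' := (converges_iff r a).mp ha
    rw [converges_iff]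
    simpa [termNorm] using ha'

variable (K) in
/-- The algebra `K{X;r}` of Laurent series `∑ a_u X^u` with `val (a_u) - r · u → +∞`. -/
def KXr (r : Fin n → ℚ) : Type _ := ↥(convergentSeries K r)

namespace KXr

variable {r : Fin n → ℚ}

noncomputable instance : AddCommGroup (KXr K r) :=
  inferInstanceAs (AddCommGroup ↥(convergentSeries K r))

/-- The coefficient of `X^u` in `f`. -/
def coeff (f : KXr K r) (u : Mon n) : K := f.1 u

lemma conv (f : KXr K r) : Converges r f.coeff := f.2

@[ext] lemma ext {f g : KXr K r} (h : ∀ u, f.coeff u = g.coeff u) : f = g :=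
  Subtype.ext (funext h)

lemma coeff_add (f g : KXr K r) (u : Mon n) : (f + g).coeff u = f.coeff u + g.coeff u := rfl

lemma coeff_zero (u : Mon n) : (0 : KXr K r).coeff u = 0 := rfl

lemma tendsto (f : KXr K r) : Tendsto (fun u => termNorm r (f.coeff u) u) cofinite (𝓝 0) :=
  (converges_iff r _).mp f.conv

lemma termNorm_mul (a b : K) (u v : Mon n) :
    termNorm r (a * b) (u + v) = termNorm r a u * termNorm r b v := by
  simp only [termNorm, norm_mul, dot_add, Real.exp_add]; ring

lemma tendsto_pair (f g : KXr K r) :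
    Tendsto (fun p : Mon n × Mon n => termNorm r (f.coeff p.1 * g.coeff p.2) (p.1 + p.2))
      cofinite (𝓝 0) := by
  simp only [termNorm_mul]
  exact tendsto_mul_cofinite_nhds_zero f.tendsto g.tendsto

lemma tendsto_of_termNorm {ι : Type*} {F : ι → K} (w : Mon n)
    (h : Tendsto (fun i => termNorm r (F i) w) cofinite (𝓝 0)) :
    Tendsto F cofinite (𝓝 0) := by
  rw [tendsto_zero_iff_norm_tendsto_zero]
  have := h.mul_const (Real.exp (dot r w))⁻¹
  simpa [termNorm, mul_assoc, Real.exp_ne_zero] using this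

lemma summable_of_tendsto {ι : Type*} {F : ι → K} (h : Tendsto F cofinite (𝓝 0)) :
    Summable F := by
  have := isUltrametric K
  have := completeSpace K
  exact NonarchimedeanAddGroup.summable_of_tendsto_cofinite_zero h

lemma summable_mul (f g : KXr K r) (w : Mon n) :
    Summable fun u => f.coeff u * g.coeff (w - u) := by
  refine summable_of_tendsto (tendsto_of_termNorm (r := r) w ?_)
  have hinj : Function.Injective fun u : Mon n => (u, w - u) := fun u v h => (Prod.mk.inj h).1
  simpa [Function.comp_def] using (tendsto_pair f g).comp hinj.tendsto_cofinite

/-- The Cauchy product of Laurent series: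
the coefficient of `X^w` is the convergent sum `∑_u a_u b_{w-u}`. -/
noncomputable instance : Mul (KXr K r) where
  mul f g := ⟨fun w => ∑' u, f.coeff u * g.coeff (w - u), by
    show Converges r _
    have := isUltrametric K
    rw [converges_iff]
    refine Metric.tendsto_nhds.mpr fun ε hε => ?_
    have hfin : {p : Mon n × Mon n |
        ¬ termNorm r (f.coeff p.1 * g.coeff p.2) (p.1 + p.2) < ε / 2}.Finite :=
      (tendsto_order.mp (tendsto_pair f g)).2 _ (by positivity)
    refine (hfin.image fun p => p.1 + p.2).subset fun w hw => ?_
    by_contra hcon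
    refine hw ?_
    show dist _ _ < _
    rw [Real.dist_eq, sub_zero, abs_of_nonneg (termNorm_nonneg _ _ _)]
    have hle : ∀ u, ‖f.coeff u * g.coeff (w - u)‖ ≤ (ε / 2) / Real.exp (dot r w) := by
      intro u
      rw [le_div_iff₀ (Real.exp_pos _)]
      by_contra hlt
      refine hcon ⟨(u, w - u), fun h => hlt ?_, by simp⟩
      simpa [termNorm] using h.le
    have := IsUltrametricDist.norm_tsum_le_of_forall_le hle
    rw [le_div_iff₀ (Real.exp_pos _)] at this
    simp only [termNorm]
    linarith⟩

lemma coeff_mul (f g : KXr K r) (w : Mon n) :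
    (f * g).coeff w = ∑' u, f.coeff u * g.coeff (w - u) := rfl

open Classical in
/-- The term `a X^u` as an element of `K{X;r}`. -/
noncomputable def term (r : Fin n → ℚ) (a : K) (u : Mon n) : KXr K r :=
  ⟨fun v => if v = u then a else 0, by
    intro N
    refine (Set.finite_singleton u).subset fun v hv => ?_
    by_contra hne
    refine hv ?_
    have hne' : v ≠ u := hne
    show (N : WithTop ℝ) ≤ _
    simp [hne', termVal, val_zero]⟩

lemma coeff_term_self (a : K) (u : Mon n) : (term r a u).coeff u = a := if_pos rfl

lemma coeff_term_of_ne (a : K) {u v : Mon n} (h : v ≠ u) : (term r a u).coeff v = 0 := if_neg h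

lemma coeff_term_mul (a : K) (u : Mon n) (f : KXr K r) (w : Mon n) :
    (term r a u * f).coeff w = a * f.coeff (w - u) := by
  rw [coeff_mul, tsum_eq_single u, coeff_term_self]
  intro v hv
  rw [coeff_term_of_ne a hv, zero_mul]

noncomputable instance : One (KXr K r) := ⟨term r 1 0⟩

lemma one_def : (1 : KXr K r) = term r 1 0 := rfl

protected lemma mul_comm (f g : KXr K r) : f * g = g * f := by
  ext w
  rw [coeff_mul, coeff_mul, ← (Equiv.subLeft w).tsum_eq]
  refine tsum_congr fun u => ?_
  simp [mul_comm]

protected lemma one_mul (f : KXr K r) : 1 * f = f := by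
  ext w
  rw [one_def, coeff_term_mul]
  simp

protected lemma mul_add (f g h : KXr K r) : f * (g + h) = f * g + f * h := by
  ext w
  rw [coeff_add, coeff_mul, coeff_mul, coeff_mul,
    ← (summable_mul f g w).tsum_add (summable_mul f h w)]
  refine tsum_congr fun u => ?_
  rw [coeff_add, mul_add]

protected lemma mul_assoc (f g h : KXr K r) : f * g * h = f * (g * h) := by
  have := isUltrametric K
  have := completeSpace K
  ext w
  have hsum : Summable (Function.uncurry fun u s : Mon n =>
      f.coeff s * g.coeff (u - s) * h.coeff (w - u)) := by
    refine summable_of_tendsto (tendsto_of_termNorm (r := r) w ?_)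
    have h3 : Tendsto (fun p : (Mon n × Mon n) × Mon n =>
        termNorm r (f.coeff p.1.1 * g.coeff p.1.2) (p.1.1 + p.1.2) *
          termNorm r (h.coeff p.2) p.2) cofinite (𝓝 0) :=
      tendsto_mul_cofinite_nhds_zero (tendsto_pair f g) h.tendsto
    have hinj : Function.Injective fun p : Mon n × Mon n => ((p.2, p.1 - p.2), w - p.1) := by
      rintro ⟨u, s⟩ ⟨u', s'⟩ e
      simp only [Prod.mk.injEq, sub_right_inj] at e
      simp [e.1.1, e.2]
    have h4 := h3.comp hinj.tendsto_cofinite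
    refine h4.congr fun p => ?_
    simp only [Function.comp, ← termNorm_mul, Function.uncurry]
    congr 1
    abel
  have hL : (f * g * h).coeff w =
      ∑' u, ∑' s, f.coeff s * g.coeff (u - s) * h.coeff (w - u) := by
    rw [coeff_mul]
    refine tsum_congr fun u => ?_
    rw [coeff_mul, tsum_mul_right]
  have hR : (f * (g * h)).coeff w =
      ∑' s, ∑' u, f.coeff s * g.coeff (u - s) * h.coeff (w - u) := by
    rw [coeff_mul]
    refine tsum_congr fun s => ?_
    rw [coeff_mul, ← tsum_mul_left, ← (Equiv.subRight s).tsum_eq]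
    refine tsum_congr fun u => ?_
    have : w - s - (u - s) = w - u := by abel
    simp [this, mul_assoc]
  rw [hL, hR]
  exact hsum.tsum_comm.symm

noncomputable instance : CommRing (KXr K r) :=
  { (inferInstance : AddCommGroup (KXr K r)) with
    mul := (· * ·)
    one := 1
    mul_assoc := KXr.mul_assoc
    mul_comm := KXr.mul_comm
    one_mul := KXr.one_mul
    mul_one := fun f => by rw [KXr.mul_comm, KXr.one_mul]
    left_distrib := KXr.mul_add
    right_distrib := fun f g h => by
      rw [KXr.mul_comm, KXr.mul_add, KXr.mul_comm h, KXr.mul_comm h]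
    zero_mul := fun f => by
      ext w; rw [coeff_mul]; simp [coeff_zero]
    mul_zero := fun f => by
      ext w; rw [coeff_mul]; simp [coeff_zero] }

/-- The minimum of the valuations of the terms is attained. -/
lemma exists_min_termVal (f : KXr K r) :
    ∃ u, ∀ w, termVal r (f.coeff u) u ≤ termVal r (f.coeff w) w := by
  by_cases h : ∀ w, termVal r (f.coeff w) w = ⊤
  · exact ⟨0, fun w => by rw [h w]; exact le_top⟩
  · push Not at h
    obtain ⟨u₀, hu₀⟩ := h
    obtain ⟨N, hN⟩ := WithTop.ne_top_iff_exists.mp hu₀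
    have hfin : {u | ¬ (((N + 1 : ℝ) : WithTop ℝ) ≤ termVal r (f.coeff u) u)}.Finite :=
      f.conv (N + 1)
    have hmem : u₀ ∈ {u | ¬ (((N + 1 : ℝ) : WithTop ℝ) ≤ termVal r (f.coeff u) u)} := by
      simp [← hN, -WithTop.coe_add]
    obtain ⟨u, _, hu'⟩ := Set.exists_min_image _ (fun u => termVal r (f.coeff u) u) hfin ⟨u₀, hmem⟩
    refine ⟨u, fun w => ?_⟩
    by_cases hw : w ∈ {u | ¬ (((N + 1 : ℝ) : WithTop ℝ) ≤ termVal r (f.coeff u) u)}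
    · exact hu' w hw
    · refine (hu' u₀ hmem).trans ?_
      rw [← hN]
      exact le_trans (by simp [-WithTop.coe_add]) (not_not.mp hw)

/-- `val_r f = min_u (val (a_u) - r · u)`. -/
noncomputable def valr (f : KXr K r) : WithTop ℝ :=
  termVal r (f.coeff f.exists_min_termVal.choose) f.exists_min_termVal.choose

lemma valr_le (f : KXr K r) (u : Mon n) : f.valr ≤ termVal r (f.coeff u) u :=
  f.exists_min_termVal.choose_spec u

lemma finite_initial (f : KXr K r) :
    {u | f.coeff u ≠ 0 ∧ termVal r (f.coeff u) u = f.valr}.Finite := by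
  by_cases h : f.valr = ⊤
  · refine Set.finite_empty.subset fun u hu => ?_
    obtain ⟨h1, h2⟩ := hu
    rw [h, termVal] at h2
    simp [val_eq_top_iff, h1] at h2
  · obtain ⟨N, hN⟩ := WithTop.ne_top_iff_exists.mp h
    refine Set.Finite.subset (f.conv (N + 1)) fun u hu => ?_
    have hu2 := hu.2
    show ¬ (((N + 1 : ℝ) : WithTop ℝ) ≤ termVal r (f.coeff u) u)
    rw [hu2, ← hN]
    simp [-WithTop.coe_add]

/-- The Laurent polynomial `in_r f`, sum of the terms of `f` of minimal valuation. -/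
noncomputable def initialForm (f : KXr K r) : AddMonoidAlgebra K (Mon n) :=
  .ofCoeff (Finsupp.onFinset f.finite_initial.toFinset
    (fun u => open Classical in if termVal r (f.coeff u) u = f.valr then f.coeff u else 0)
    (fun u hu => by
      classical
      simp only [ne_eq, ite_eq_right_iff, Classical.not_imp] at hu
      simpa using ⟨hu.2, hu.1⟩))

/-- Convergence of a sequence in `K{X;r}` for `val_r`. -/
def TendsTo (x : ℕ → KXr K r) (y : KXr K r) : Prop :=
  ∀ N : ℝ, ∀ᶠ k in atTop, (N : WithTop ℝ) ≤ (x k - y).valr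

end KXr

end Algebra

/-! ## Conic decompositions, generalized monomial orders, leading monomials -/

section Order

variable {n : ℕ} {I : Type*}

/-- `(T_i)_{i ∈ I}` is a conic decomposition of the group `T` of monomials (`I` finite). -/
structure IsConicDecomposition (T : I → AddSubmonoid (Mon n)) : Prop where
  fg : ∀ i, (T i).FG
  eq_zero_of_neg_mem : ∀ i, ∀ t ∈ T i, -t ∈ T i → t = 0
  closure_eq_top : ∀ i, AddSubgroup.closure (T i : Set (Mon n)) = ⊤
  iUnion_eq_univ : (⋃ i, (T i : Set (Mon n))) = Set.univ

/-- The total order on `T` is a generalized monomial order for `(T_i)_{i ∈ I}`. -/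
structure IsGMO [LinearOrder (Mon n)] (T : I → AddSubmonoid (Mon n)) : Prop where
  zero_le : ∀ t : Mon n, 0 ≤ t
  add_lt_add : ∀ (s t u : Mon n) (i : I), s ∈ T i → t ∈ T i → u < s → u + t < s + t

variable {K : Type*} [Field K] [LinearOrder (Mon n)]

/-- The leading monomial of a Laurent polynomial (with the convention `lm 0 = 1`). -/
noncomputable def lm (p : AddMonoidAlgebra K (Mon n)) : Mon n :=
  if h : p.coeff.support.Nonempty then p.coeff.support.max' h else 0

/-- The leading coefficient of a Laurent polynomial. -/
noncomputable def lc (p : AddMonoidAlgebra K (Mon n)) : K := p.coeff (lm p)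

/-- `T_i(p)`, the set of monomials `t` with `lm (t p) ∈ T_i`. -/
def shifts (T : I → AddSubmonoid (Mon n)) (i : I) (p : AddMonoidAlgebra K (Mon n)) :
    Set (Mon n) :=
  {t | lm (AddMonoidAlgebra.single t 1 * p) ∈ T i}

open Classical in
/-- `lm_i(p) = lm (t p) t⁻¹` for any `t ∈ T_i(p)`. -/
noncomputable def lmCone (T : I → AddSubmonoid (Mon n)) (i : I)
    (p : AddMonoidAlgebra K (Mon n)) : Mon n :=
  if h : (shifts T i p).Nonempty then lm (AddMonoidAlgebra.single h.some 1 * p) - h.some else 0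

/-- `lc_i(p)`, the coefficient of `lm_i(p)` in `p`. -/
noncomputable def lcCone (T : I → AddSubmonoid (Mon n)) (i : I)
    (p : AddMonoidAlgebra K (Mon n)) : K := p.coeff (lmCone T i p)

end Order

/-! ## Division, Gröbner bases and Buchberger's algorithm in `K{X;r}` -/

section Groebner

open KXr
open scoped Pointwise

variable {K : Type*} [Field K] [CompleteDVField K] {n : ℕ} {r : Fin n → ℚ} {I : Type*}
  [LinearOrder (Mon n)] (T : I → AddSubmonoid (Mon n))

/-- The leading term of `f ∈ K{X;r}`. -/
noncomputable def lt (f : KXr K r) : KXr K r := term r (lc f.initialForm) (lm f.initialForm)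

/-- `lm_i(f) T_i(f)`. -/
noncomputable def leadSet (i : I) (f : KXr K r) : Set (Mon n) :=
  {w | ∃ t ∈ shifts T i f.initialForm, w = lmCone T i f.initialForm + t}

/-- `G` is a Gröbner basis of the ideal `J`:
a finite subset of `J \ {0}` with `lm(J) = ⋃_{g ∈ G, i ∈ I} T_i(g) lm_i(g)`. -/
structure IsGroebnerBasis (J : Ideal (KXr K r)) (G : Finset (KXr K r)) : Prop where
  mem : ∀ g ∈ G, g ∈ J
  ne_zero : ∀ g ∈ G, g ≠ 0
  lm_eq : {w | ∃ f ∈ J, f ≠ 0 ∧ w = lm f.initialForm} = ⋃ g ∈ G, ⋃ i, leadSet T i g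

/-- The state `(f, (q_g)_g, s)` of the division algorithm. -/
structure DivState (K : Type*) [Field K] [CompleteDVField K] {n : ℕ} (r : Fin n → ℚ) where
  /-- what remains to be divided -/
  rest : KXr K r
  /-- the quotients, indexed by the divisors -/
  quot : KXr K r → KXr K r
  /-- the remainder -/
  rem : KXr K r

/-- The test of the division algorithm: `lm ((lm f / lm_i g) g) = lm f`. -/
def Reduces (i : I) (g f : KXr K r) : Prop :=
  lm (term r 1 (lm f.initialForm - lmCone T i g.initialForm) * g).initialForm = lm f.initialForm

/-- The term `lt f / lt_i g`. -/
noncomputable def quotTerm (i : I) (g f : KXr K r) : KXr K r :=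
  term r (lc f.initialForm / lcCone T i g.initialForm)
    (lm f.initialForm - lmCone T i g.initialForm)

open Classical in
/-- One step of the multivariate division by the finite set `G`. -/
inductive DivStep (G : Finset (KXr K r)) : DivState K r → DivState K r → Prop
  /-- cancel the leading term with some `g ∈ G` for which the test succeeds -/
  | reduce (f : KXr K r) (q : KXr K r → KXr K r) (s : KXr K r) (i : I) (g : KXr K r) :
      f ≠ 0 → g ∈ G → Reduces T i g f →
      DivStep G ⟨f, q, s⟩
        ⟨f - quotTerm T i g f * g, Function.update q g (q g + quotTerm T i g f), s⟩
  /-- if the test fails for all `i` and `g`, move the leading term to the remainder -/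
  | move (f : KXr K r) (q : KXr K r → KXr K r) (s : KXr K r) :
      f ≠ 0 → (∀ (i : I), ∀ g ∈ G, ¬ Reduces T i g f) →
      DivStep G ⟨f, q, s⟩ ⟨f - lt f, q, s + lt f⟩
  /-- once `f = 0`, nothing changes any more -/
  | halt (q : KXr K r → KXr K r) (s : KXr K r) : DivStep G ⟨0, q, s⟩ ⟨0, q, s⟩

/-- A run of the multivariate division of `f` by `G` (with countably many steps). -/
def IsDivRun (f : KXr K r) (G : Finset (KXr K r)) (σ : ℕ → DivState K r) : Prop :=
  σ 0 = ⟨f, fun _ => 0, 0⟩ ∧ ∀ k, DivStep T G (σ k) (σ (k + 1))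

/-- The run `σ` converges, with output the quotients `q` and the remainder `s`. -/
def DivRunOutputs (σ : ℕ → DivState K r) (q : KXr K r → KXr K r) (s : KXr K r) : Prop :=
  TendsTo (fun k => (σ k).rest) 0 ∧ (∀ g, TendsTo (fun k => (σ k).quot g) (q g)) ∧
    TendsTo (fun k => (σ k).rem) s

/-- `s` is a remainder output by the multivariate division of `f` by `G`. -/
def IsRemainder (f : KXr K r) (G : Finset (KXr K r)) (s : KXr K r) : Prop :=
  ∃ σ q, IsDivRun T f G σ ∧ DivRunOutputs σ q s

/-- The S-pair `S(i,f,g,v) = lc_i(g) (v / lm_i f) f - lc_i(f) (v / lm_i g) g`. -/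
noncomputable def sPair (i : I) (f g : KXr K r) (v : Mon n) : KXr K r :=
  term r (lcCone T i g.initialForm) (v - lmCone T i f.initialForm) * f -
    term r (lcCone T i f.initialForm) (v - lmCone T i g.initialForm) * g

/-- `U` is a finite set of generators of the `T_i`-module
`lm_i(f) T_i(f) ∩ lm_i(g) T_i(g)`. -/
def IsGeneratingSet (i : I) (f g : KXr K r) (U : Finset (Mon n)) : Prop :=
  (T i : Set (Mon n)) + (U : Set (Mon n)) = leadSet T i f ∩ leadSet T i g

/-- The position in the nested loops of Buchberger's algorithm. -/
inductive Phase (A I M : Type*)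
  /-- at the head of the outer `while` loop -/
  | outer : Phase A I M
  /-- treating the pair `(f, g)`, with the set `R` of cones still to be treated -/
  | cones (f g : A) (R : Finset I) : Phase A I M
  /-- treating the pair `(f, g)` in the cone `i`, with the set `V` of generators and
  the set `R` of cones still to be treated -/
  | gens (f g : A) (i : I) (V : Finset M) (R : Finset I) : Phase A I M

/-- The state of Buchberger's algorithm: the sets `H` and `B` and the position in the loops. -/
structure BuchState (A I M : Type*) where
  /-- the current generators `H` -/
  basis : Finset A
  /-- the pairs `B` still to be treated -/
  pairs : Finset (A × A)
  /-- the position in the loops -/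
  phase : Phase A I M

open Classical in
/-- The initial state: `H = {h_1, …, h_m}` and `B = {(h_i, h_j) : i < j}`. -/
noncomputable def BuchState.init {A : Type*} (I M : Type*) {m : ℕ} (h : Fin m → A) :
    BuchState A I M :=
  ⟨Finset.univ.image h,
    ((Finset.univ : Finset (Fin m × Fin m)).filter fun p => p.1 < p.2).image
      fun p => (h p.1, h p.2),
    .outer⟩

/-- The algorithm returns `H` when `B` is empty at the head of the outer loop. -/
def BuchState.IsFinal {A I M : Type*} (S : BuchState A I M) : Prop :=
  S.phase = .outer ∧ S.pairs = ∅

open Classical in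
/-- One step of Buchberger's algorithm in `K{X;r}`. All choices (of a pair, of the order of the
loops, of the generators, of the reductions in the division) are left free. -/
inductive BuchStep [Fintype I] :
    BuchState (KXr K r) I (Mon n) → BuchState (KXr K r) I (Mon n) → Prop
  /-- take a pair out of `B` and enter the loop over the cones -/
  | selectPair (H : Finset (KXr K r)) (B : Finset (KXr K r × KXr K r)) (f g : KXr K r) :
      (f, g) ∈ B →
      BuchStep ⟨H, B, .outer⟩ ⟨H, B.erase (f, g), .cones f g Finset.univ⟩
  /-- take a cone, choose generators `U(i,f,g)` and enter the loop over them -/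
  | selectCone (H : Finset (KXr K r)) (B : Finset (KXr K r × KXr K r)) (f g : KXr K r)
      (R : Finset I) (i : I) (U : Finset (Mon n)) :
      i ∈ R → IsGeneratingSet T i f g U →
      BuchStep ⟨H, B, .cones f g R⟩ ⟨H, B, .gens f g i U (R.erase i)⟩
  /-- call the division of `S(i,f,g,v)` by `H`, with remainder zero -/
  | divideZero (H : Finset (KXr K r)) (B : Finset (KXr K r × KXr K r)) (f g : KXr K r)
      (i : I) (V : Finset (Mon n)) (R : Finset I) (v : Mon n) :
      v ∈ V → IsRemainder T (sPair T i f g v) H 0 →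
      BuchStep ⟨H, B, .gens f g i V R⟩ ⟨H, B, .gens f g i (V.erase v) R⟩
  /-- call the division of `S(i,f,g,v)` by `H`, with remainder `s ≠ 0`, and add `s` to `H` -/
  | divideNonzero (H : Finset (KXr K r)) (B : Finset (KXr K r × KXr K r)) (f g : KXr K r)
      (i : I) (V : Finset (Mon n)) (R : Finset I) (v : Mon n) (s : KXr K r) :
      v ∈ V → IsRemainder T (sPair T i f g v) H s → s ≠ 0 →
      BuchStep ⟨H, B, .gens f g i V R⟩
        ⟨insert s H, B ∪ H.image (fun h => (h, s)), .gens f g i (V.erase v) R⟩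
  /-- end of the loop over the generators -/
  | endGens (H : Finset (KXr K r)) (B : Finset (KXr K r × KXr K r)) (f g : KXr K r)
      (i : I) (R : Finset I) :
      BuchStep ⟨H, B, .gens f g i ∅ R⟩ ⟨H, B, .cones f g R⟩
  /-- end of the loop over the cones -/
  | endCones (H : Finset (KXr K r)) (B : Finset (KXr K r × KXr K r)) (f g : KXr K r) :
      BuchStep ⟨H, B, .cones f g ∅⟩ ⟨H, B, .outer⟩

/-- In the state `S`, the next step calls the division of `p` by `S.basis`. -/
def CallsDivision (S : BuchState (KXr K r) I (Mon n)) (p : KXr K r) : Prop :=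
  ∃ f g i V R, ∃ v ∈ V, S.phase = .gens f g i V R ∧ p = sPair T i f g v

end Groebner

end LaurentGB

open LaurentGB

/-! Call level the pair (valuation, leading monomial), counted as lower when the valuation is larger
or, at equal valuation, when the monomial is smaller. Every reduction lowers the level. The monomial
order is a well-order, by Dickson's lemma applied inside one of the finitely many cones. The
valuations, however, need not lie in a discrete subset of ℝ, since the numbers r · u and the
generator ϖ of the value group of K may be incommensurable. The remedy is that only finitely many
valuations at most N can occur in a given computation: they arise from a finite set by adding
nonnegative increments taken from a finite set that contains ϖ (`exists_finite_add_closed`). So the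
levels met in a division cannot decrease forever below a bound N, and the division converges
(`IsDivRun.tendsTo_rest`).

Correctness is Buchberger's criterion (`lm_mem_leadSet_of_coneDone`). Dividing an S-pair, and adding
the remainder to the basis, writes the S-pair, up to terms of arbitrarily large valuation, as a
finite sum of term multiples of basis elements, all of lower level than the two terms that cancel.
Inside one cone such a representation can be translated without changing its increments of
valuation, so a finite set of generators controls all S-pairs with one finite set of increments
(`exists_forall_isStandardIn`). For f ≠ 0 in the ideal, consider the representations of f modulo
valuation greater than val_r f, with valuations in the resulting finite set, and take one whose
highest level (v, m) is lowest possible. The S-pairs merge its summands of that level into one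
multiple of a single basis element h, up to lower terms. If cancellation makes the merged
coefficient vanish or raises its valuation, the level drops, a contradiction. Otherwise m is the
leading monomial of f and belongs to a leading set of h.

Termination: no exponent of a remainder lies in a leading set of the current basis
(`IsRemainder.notMem_leadSet`), so infinitely many nonzero remainders would contradict Dickson's
lemma; while the basis is unchanged, a lexicographic measure of the loops decreases
(`BuchInvariant.basis_or_measure`). -/

namespace LaurentGB

open Filter Topology KXr

/-! ### The valuation val_r and its topology -/

section Values

variable {K : Type*} [Field K] [CompleteDVField K] {n : ℕ} {r : Fin n → ℚ}

attribute [local instance] normedField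

lemma val_neg (x : K) : val (-x) = val x := (CompleteDVField.val (K := K)).map_neg x

lemma termVal_zero (u : Mon n) : termVal r (0 : K) u = ⊤ := by simp [termVal, val_zero]

lemma termVal_eq_top_iff {a : K} {u : Mon n} : termVal r a u = ⊤ ↔ a = 0 := by
  simp [termVal, val_eq_top_iff]

lemma exists_termVal_eq {a : K} (ha : a ≠ 0) (u : Mon n) : ∃ c : ℝ, termVal r a u = c := by
  obtain ⟨c, hc⟩ := WithTop.ne_top_iff_exists.mp (mt (termVal_eq_top_iff (r := r) (u := u)).mp ha)
  exact ⟨c, hc.symm⟩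

lemma termVal_mul (a b : K) (u v : Mon n) :
    termVal r (a * b) (u + v) = termVal r a u + termVal r b v := by
  have : ((-dot r (u + v) : ℝ) : WithTop ℝ) = ((-dot r u : ℝ) : WithTop ℝ) + (-dot r v : ℝ) := by
    rw [← WithTop.coe_add, dot_add, neg_add]
  rw [termVal, val_mul, this, termVal, termVal, add_add_add_comm]

lemma termVal_neg (a : K) (u : Mon n) : termVal r (-a) u = termVal r a u := by
  rw [termVal, termVal, val_neg]

lemma min_termVal_le_add (a b : K) (u : Mon n) :
    min (termVal r a u) (termVal r b u) ≤ termVal r (a + b) u := by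
  simp only [termVal]
  rcases le_total (val a) (val b) with h | h
  · exact (min_le_left _ _).trans
      (add_le_add_left ((min_eq_left h).symm.le.trans (val_add a b)) _)
  · exact (min_le_right _ _).trans
      (add_le_add_left ((min_eq_right h).symm.le.trans (val_add a b)) _)

lemma termVal_add_eq_of_lt {a b : K} {u : Mon n} (h : termVal r a u < termVal r b u) :
    termVal r (a + b) u = termVal r a u := by
  refine le_antisymm ?_ ((min_eq_left h.le).symm.le.trans (min_termVal_le_add a b u))
  by_contra! hlt
  have := min_termVal_le_add (r := r) (a + b) (-b) u
  rw [add_neg_cancel_right, termVal_neg] at this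
  exact absurd this (not_le.mpr (lt_min hlt h))

namespace KXr

/-- The valuation `val (a_u) - r · u` of the term of `f` of exponent `u`. -/
noncomputable def coeffVal (f : KXr K r) (u : Mon n) : WithTop ℝ := termVal r (f.coeff u) u

lemma coeff_sub (f g : KXr K r) (u : Mon n) : (f - g).coeff u = f.coeff u - g.coeff u := rfl

lemma coeffVal_zero (u : Mon n) : coeffVal (0 : KXr K r) u = ⊤ := termVal_zero u

lemma coeffVal_neg (f : KXr K r) (u : Mon n) : coeffVal (-f) u = coeffVal f u := termVal_neg _ _

lemma min_coeffVal_le_add (f g : KXr K r) (u : Mon n) :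
    min (coeffVal f u) (coeffVal g u) ≤ coeffVal (f + g) u := min_termVal_le_add _ _ u

lemma coeffVal_add_eq_of_lt {f g : KXr K r} {u : Mon n} (h : coeffVal f u < coeffVal g u) :
    coeffVal (f + g) u = coeffVal f u := termVal_add_eq_of_lt h

lemma exists_coeffVal_eq_valr (f : KXr K r) : ∃ u, coeffVal f u = f.valr := ⟨_, rfl⟩

lemma le_valr_iff {f : KXr K r} {N : WithTop ℝ} : N ≤ f.valr ↔ ∀ u, N ≤ coeffVal f u := by
  refine ⟨fun h u => h.trans (f.valr_le u), fun h => ?_⟩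
  obtain ⟨u, hu⟩ := f.exists_coeffVal_eq_valr
  exact hu ▸ h u

lemma lt_valr_iff {f : KXr K r} {N : WithTop ℝ} : N < f.valr ↔ ∀ u, N < coeffVal f u := by
  refine ⟨fun h u => h.trans_le (f.valr_le u), fun h => ?_⟩
  obtain ⟨u, hu⟩ := f.exists_coeffVal_eq_valr
  exact hu ▸ h u

lemma valr_eq_top_iff {f : KXr K r} : f.valr = ⊤ ↔ f = 0 := by
  rw [eq_top_iff, le_valr_iff]
  refine ⟨fun h => ?_, ?_⟩
  · ext u
    rw [coeff_zero]
    exact termVal_eq_top_iff.mp (top_le_iff.mp (h u))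
  · rintro rfl u
    rw [coeffVal_zero]

lemma valr_zero : (0 : KXr K r).valr = ⊤ := valr_eq_top_iff.mpr rfl

lemma exists_valr_eq {f : KXr K r} (hf : f ≠ 0) : ∃ v : ℝ, f.valr = v := by
  obtain ⟨v, hv⟩ := WithTop.ne_top_iff_exists.mp (mt valr_eq_top_iff.mp hf)
  exact ⟨v, hv.symm⟩

lemma ne_zero_of_valr_eq {f : KXr K r} {v : ℝ} (h : f.valr = v) : f ≠ 0 := by
  rintro rfl
  simp [valr_zero] at h

lemma valr_neg (f : KXr K r) : (-f).valr = f.valr := by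
  refine le_antisymm (le_valr_iff.mpr fun u => ?_) (le_valr_iff.mpr fun u => ?_)
  · exact (le_valr_iff.mp le_rfl u).trans_eq (coeffVal_neg f u)
  · exact (le_valr_iff.mp le_rfl u).trans_eq (coeffVal_neg f u).symm

lemma min_valr_le_add (f g : KXr K r) : min f.valr g.valr ≤ (f + g).valr :=
  le_valr_iff.mpr fun u =>
    (min_le_min (f.valr_le u) (g.valr_le u)).trans (min_coeffVal_le_add f g u)

lemma coeffVal_term_mul (a : K) (w : Mon n) (f : KXr K r) (u : Mon n) :
    coeffVal (term r a w * f) u = termVal r a w + coeffVal f (u - w) := by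
  rw [coeffVal, coeff_term_mul, coeffVal, ← termVal_mul, add_sub_cancel]

lemma term_mul_term (a b : K) (u v : Mon n) :
    term r a u * term r b v = term r (a * b) (u + v) := by
  ext w
  rw [coeff_term_mul]
  by_cases h : w = u + v
  · subst h
    rw [coeff_term_self, add_sub_cancel_left, coeff_term_self]
  · rw [coeff_term_of_ne _ h, coeff_term_of_ne, mul_zero]
    rintro rfl
    exact h (by abel)

lemma term_add (a b : K) (u : Mon n) : term r (a + b) u = term r a u + term r b u := by
  ext w
  rw [coeff_add]
  by_cases h : w = u
  · subst h
    simp only [coeff_term_self]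
  · simp only [coeff_term_of_ne _ h, add_zero]

lemma term_zero (u : Mon n) : term r (0 : K) u = 0 := by
  ext w
  by_cases h : w = u
  · subst h
    rw [coeff_term_self, coeff_zero]
  · rw [coeff_term_of_ne _ h, coeff_zero]

lemma term_neg (a : K) (u : Mon n) : term r (-a) u = -term r a u := by
  rw [eq_neg_iff_add_eq_zero, ← term_add, neg_add_cancel, term_zero]

lemma valr_term_mul (a : K) (w : Mon n) (f : KXr K r) :
    (term r a w * f).valr = termVal r a w + f.valr := by
  refine le_antisymm ?_ (le_valr_iff.mpr fun u => ?_)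
  · obtain ⟨u, hu⟩ := f.exists_coeffVal_eq_valr
    have := (term r a w * f).valr_le (u + w)
    rw [← coeffVal, coeffVal_term_mul, add_sub_cancel_right, hu] at this
    exact this
  · rw [coeffVal_term_mul]
    exact add_le_add_right (f.valr_le _) _

lemma valr_term (a : K) (w : Mon n) : (term r a w).valr = termVal r a w := by
  refine le_antisymm ?_ (le_valr_iff.mpr fun u => ?_)
  · have := (term r a w).valr_le w
    rwa [coeff_term_self] at this
  · by_cases h : u = w
    · subst h
      rw [coeffVal, coeff_term_self]
    · rw [coeffVal, coeff_term_of_ne _ h, termVal_zero]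
      exact le_top

/-- The ultrametric inequality bounds the convergent sum defining each coefficient. Only this
inequality is needed, for the continuity of multiplication. -/
lemma coe_le_valr_mul {f g : KXr K r} {a b : ℝ} (hf : (a : WithTop ℝ) ≤ f.valr)
    (hg : (b : WithTop ℝ) ≤ g.valr) : ((a + b : ℝ) : WithTop ℝ) ≤ (f * g).valr := by
  have := isUltrametric K
  refine le_valr_iff.mpr fun w => ?_
  rw [coeffVal, le_termVal_iff, termNorm, ← le_div_iff₀ (Real.exp_pos _), coeff_mul]
  refine IsUltrametricDist.norm_tsum_le_of_forall_le fun u => ?_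
  rw [le_div_iff₀ (Real.exp_pos _)]
  have h := (le_termVal_iff r (f.coeff u * g.coeff (w - u)) (u + (w - u)) (a + b)).mp (by
    rw [termVal_mul, WithTop.coe_add]
    exact add_le_add (hf.trans (f.valr_le u)) (hg.trans (g.valr_le _)))
  rwa [add_sub_cancel, termNorm] at h

/-- The series of valuation greater than `N`. -/
def valGt (r : Fin n → ℚ) (N : ℝ) : AddSubgroup (KXr K r) where
  carrier := {f | (N : WithTop ℝ) < f.valr}
  zero_mem' := (WithTop.coe_lt_top N).trans_eq valr_zero.symm
  add_mem' := fun {f g} hf hg => (lt_min hf hg).trans_le (min_valr_le_add f g)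
  neg_mem' := fun {f} hf => lt_of_lt_of_eq hf (valr_neg f).symm

lemma mem_valGt {N : ℝ} {f : KXr K r} : f ∈ valGt r N ↔ (N : WithTop ℝ) < f.valr := Iff.rfl

lemma valGt_anti {N N' : ℝ} (h : N ≤ N') : (valGt r N' : AddSubgroup (KXr K r)) ≤ valGt r N :=
  fun _ hf => (WithTop.coe_le_coe.mpr h).trans_lt hf

lemma eq_zero_of_forall_mem_valGt {f : KXr K r} (h : ∀ N, f ∈ valGt r N) : f = 0 := by
  by_contra hf
  obtain ⟨v, hv⟩ := exists_valr_eq hf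
  exact absurd (mem_valGt.mp (h v)) (by rw [hv]; exact lt_irrefl _)

lemma term_mul_mem_valGt {a : K} {w : Mon n} {c N : ℝ} (hc : termVal r a w = c) {f : KXr K r}
    (hf : f ∈ valGt r N) : term r a w * f ∈ valGt r (c + N) := by
  rw [mem_valGt, valr_term_mul, hc, WithTop.coe_add]
  exact (WithTop.add_lt_add_iff_left WithTop.coe_ne_top).mpr hf

/-- Replacing N by N + 1 turns weak inequalities into strict ones, so limits can be handled with the
subgroups `valGt`. -/
lemma tendsTo_iff {x : ℕ → KXr K r} {y : KXr K r} :
    TendsTo x y ↔ ∀ N, ∀ᶠ k in atTop, x k - y ∈ valGt r N := by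
  refine ⟨fun h N => (h (N + 1)).mono fun k hk => ?_, fun h N => (h N).mono fun k hk => hk.le⟩
  exact (WithTop.coe_lt_coe.mpr (lt_add_one N)).trans_le hk

lemma TendsTo.sub {x x' : ℕ → KXr K r} {y y' : KXr K r} (h : TendsTo x y) (h' : TendsTo x' y') :
    TendsTo (fun k => x k - x' k) (y - y') := by
  rw [tendsTo_iff] at *
  intro N
  filter_upwards [h N, h' N] with k hk hk'
  have := sub_mem hk hk'
  rwa [sub_sub_sub_comm] at this

lemma TendsTo.add {x x' : ℕ → KXr K r} {y y' : KXr K r} (h : TendsTo x y) (h' : TendsTo x' y') :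
    TendsTo (fun k => x k + x' k) (y + y') := by
  rw [tendsTo_iff] at *
  intro N
  filter_upwards [h N, h' N] with k hk hk'
  have := add_mem hk hk'
  rwa [sub_add_sub_comm] at this

lemma tendsTo_const (y : KXr K r) : TendsTo (fun _ => y) y := by
  rw [tendsTo_iff]
  intro N
  simp [zero_mem]

lemma TendsTo.mul_const {x : ℕ → KXr K r} {y : KXr K r} (h : TendsTo x y) (g : KXr K r) :
    TendsTo (fun k => x k * g) (y * g) := by
  by_cases hg : g = 0
  · simpa [hg] using tendsTo_const (r := r) (0 : KXr K r)
  obtain ⟨v, hv⟩ := exists_valr_eq hg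
  intro N
  filter_upwards [h (N - v)] with k hk
  have := coe_le_valr_mul hk hv.symm.le
  rwa [sub_add_cancel, sub_mul] at this

lemma tendsTo_sum {ι : Type*} (s : Finset ι) {x : ι → ℕ → KXr K r} {y : ι → KXr K r}
    (h : ∀ i ∈ s, TendsTo (x i) (y i)) :
    TendsTo (fun k => ∑ i ∈ s, x i k) (∑ i ∈ s, y i) := by
  classical
  induction s using Finset.induction_on with
  | empty => simpa using tendsTo_const (r := r) (0 : KXr K r)
  | insert a s ha ih =>
    simp only [Finset.sum_insert ha]
    exact (h a (Finset.mem_insert_self a s)).add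
      (ih fun i hi => h i (Finset.mem_insert_of_mem hi))

lemma TendsTo.unique {x : ℕ → KXr K r} {y y' : KXr K r} (h : TendsTo x y) (h' : TendsTo x y') :
    y = y' := by
  have := tendsTo_iff.mp (h.sub h')
  rw [← sub_eq_zero, ← neg_eq_zero]
  refine eq_zero_of_forall_mem_valGt fun N => ?_
  obtain ⟨k, hk⟩ := (this N).exists
  simpa using hk

/-- A sequence whose successive differences tend to zero converges. -/
lemma exists_tendsTo {x : ℕ → KXr K r}
    (h : ∀ N : ℝ, ∀ᶠ k in atTop, x (k + 1) - x k ∈ valGt r N) : ∃ y, TendsTo x y := by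
  have hc : ∀ N : ℝ, ∃ k₀, ∀ k ≥ k₀, ∀ l ≥ k₀, x k - x l ∈ valGt r N := by
    intro N
    obtain ⟨k₀, hk₀⟩ := eventually_atTop.mp (h N)
    have h1 : ∀ k ≥ k₀, x k - x k₀ ∈ valGt r N := by
      intro k hk
      induction k, hk using Nat.le_induction with
      | base => rw [sub_self]; exact zero_mem _
      | succ k hk ih =>
        have := add_mem (hk₀ k hk) ih
        rwa [sub_add_sub_cancel] at this
    refine ⟨k₀, fun k hk l hl => ?_⟩
    have := sub_mem (h1 k hk) (h1 l hl)
    rwa [sub_sub_sub_cancel_right] at this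
  have hval : ∀ (u : Mon n) (N : ℝ) (a : K), ((N - dot r u : ℝ) : WithTop ℝ) ≤ termVal r a u →
      (N : WithTop ℝ) ≤ val a := by
    intro u N a ha
    rw [le_termVal_iff, termNorm, ← le_div_iff₀ (Real.exp_pos _), ← Real.exp_sub] at ha
    rw [le_val_iff_norm]
    exact ha.trans_eq (congrArg Real.exp (by ring))
  have hval' : ∀ (u : Mon n) (N : ℝ) (a : K), ((N + dot r u : ℝ) : WithTop ℝ) ≤ val a →
      (N : WithTop ℝ) ≤ termVal r a u := by
    intro u N a ha
    rw [le_val_iff_norm] at ha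
    rw [le_termVal_iff, termNorm, ← le_div_iff₀ (Real.exp_pos _), ← Real.exp_sub]
    exact ha.trans_eq (congrArg Real.exp (by ring))
  have hlim : ∀ u : Mon n, ∃ y : K, ∀ N : ℝ, ∃ k₀, ∀ k ≥ k₀,
      (N : WithTop ℝ) ≤ val ((x k).coeff u - y) := by
    intro u
    refine CompleteDVField.complete (fun k => (x k).coeff u) fun N => ?_
    obtain ⟨k₀, hk₀⟩ := hc (N - dot r u)
    refine ⟨k₀, fun k hk l hl => hval u N _ ?_⟩
    exact (lt_valr_iff.mp (hk₀ k hk l hl) u).le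
  choose y hy using hlim
  -- The index k₁ depends on u, but comparison with the term of index max k₀ k₁ gives a bound that
  -- holds for all u from the same k₀ on. This uniformity makes y a convergent series and the
  -- convergence one for val_r.
  have key : ∀ N : ℝ, ∃ k₀, ∀ k ≥ k₀, ∀ u, (N : WithTop ℝ) ≤ termVal r ((x k).coeff u - y u) u := by
    intro N
    obtain ⟨k₀, hk₀⟩ := hc N
    refine ⟨k₀, fun k hk u => ?_⟩
    obtain ⟨k₁, hk₁⟩ := hy u (N + dot r u)
    have h1 := hval' u N _ (hk₁ (max k₀ k₁) (le_max_right _ _))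
    have h2 := (lt_valr_iff.mp (hk₀ k hk (max k₀ k₁) (le_max_left _ _)) u).le
    have h3 := (le_min h2 h1).trans (min_termVal_le_add _ _ u)
    rwa [coeff_sub, sub_add_sub_cancel] at h3
  have hconv : Converges r y := by
    intro N
    obtain ⟨k₀, hk₀⟩ := key N
    filter_upwards [(x k₀).conv N] with u hu
    have h1 := hk₀ k₀ le_rfl u
    rw [← termVal_neg] at h1
    have h3 := (le_min hu h1).trans (min_termVal_le_add _ _ u)
    rwa [neg_sub, add_sub_cancel] at h3
  refine ⟨⟨y, hconv⟩, fun N => ?_⟩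
  obtain ⟨k₀, hk₀⟩ := key N
  filter_upwards [eventually_ge_atTop k₀] with k hk
  exact le_valr_iff.mpr fun u => hk₀ k hk u

lemma initialForm_coeff (f : KXr K r) (u : Mon n) [Decidable (coeffVal f u = f.valr)] :
    f.initialForm.coeff u = if coeffVal f u = f.valr then f.coeff u else 0 := by
  classical
  have : f.initialForm.coeff u = if termVal r (f.coeff u) u = f.valr then f.coeff u else 0 := by
    simp only [initialForm, AddMonoidAlgebra.coeff_ofCoeff, Finsupp.onFinset_apply]
  rw [this]
  exact if_congr Iff.rfl rfl rfl

lemma initialForm_coeff_of_coeffVal_eq {f : KXr K r} {u : Mon n} (h : coeffVal f u = f.valr) :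
    f.initialForm.coeff u = f.coeff u := by
  classical
  rw [initialForm_coeff, if_pos h]

/-- Multiplication by a monomial changes all valuations of terms by the same constant. This lets the
cone notions, defined on Laurent polynomials, be studied on series. -/
lemma initialForm_term_mul (t : Mon n) (f : KXr K r) :
    (term r 1 t * f).initialForm = AddMonoidAlgebra.single t 1 * f.initialForm := by
  classical
  ext u
  obtain ⟨c, hc⟩ := exists_termVal_eq (r := r) (one_ne_zero (α := K)) t
  rw [AddMonoidAlgebra.coeff_single_mul_apply, initialForm_coeff, initialForm_coeff,
    coeffVal_term_mul, valr_term_mul, hc, coeff_term_mul, neg_add_eq_sub, one_mul, one_mul]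
  exact if_congr (WithTop.add_left_inj WithTop.coe_ne_top) rfl rfl

lemma mem_support_initialForm {f : KXr K r} {v : ℝ} (h : f.valr = v) {u : Mon n} :
    u ∈ f.initialForm.coeff.support ↔ coeffVal f u = v := by
  classical
  rw [Finsupp.mem_support_iff, initialForm_coeff, h]
  simp only [ne_eq, ite_eq_right_iff, Classical.not_imp, and_iff_left_iff_imp]
  intro h1 h2
  rw [coeffVal, h2, termVal_zero] at h1
  exact WithTop.top_ne_coe h1

end KXr

end Values

/-! ### Levels: valuation and leading monomial -/

section Leading

variable {K : Type*} [Field K] [CompleteDVField K] {n : ℕ} {r : Fin n → ℚ} [LinearOrder (Mon n)]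

namespace KXr

/-- `v` is the valuation of `f` and `m` its leading monomial. -/
structure HasLead (f : KXr K r) (v : ℝ) (m : Mon n) : Prop where
  coeffVal_eq : coeffVal f m = v
  le_coeffVal : ∀ u, (v : WithTop ℝ) ≤ coeffVal f u
  lt_coeffVal : ∀ u, m < u → (v : WithTop ℝ) < coeffVal f u

lemma HasLead.valr_eq {f : KXr K r} {v : ℝ} {m : Mon n} (h : HasLead f v m) : f.valr = v :=
  le_antisymm ((f.valr_le m).trans_eq h.coeffVal_eq) (le_valr_iff.mpr h.le_coeffVal)

lemma HasLead.ne_zero {f : KXr K r} {v : ℝ} {m : Mon n} (h : HasLead f v m) : f ≠ 0 :=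
  ne_zero_of_valr_eq h.valr_eq

lemma HasLead.lm_eq {f : KXr K r} {v : ℝ} {m : Mon n} (h : HasLead f v m) :
    lm f.initialForm = m := by
  have hm : m ∈ f.initialForm.coeff.support := (mem_support_initialForm h.valr_eq).mpr h.coeffVal_eq
  rw [lm, dif_pos ⟨m, hm⟩]
  refine le_antisymm (Finset.max'_le _ _ _ fun u hu => ?_) (Finset.le_max' _ _ hm)
  by_contra! hlt
  exact (h.lt_coeffVal u hlt).ne' ((mem_support_initialForm h.valr_eq).mp hu)

lemma hasLead {f : KXr K r} {v : ℝ} (h : f.valr = v) : HasLead f v (lm f.initialForm) := by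
  obtain ⟨u₀, hu₀⟩ := f.exists_coeffVal_eq_valr
  have hne : f.initialForm.coeff.support.Nonempty :=
    ⟨u₀, (mem_support_initialForm h).mpr (hu₀.trans h)⟩
  rw [lm, dif_pos hne]
  refine ⟨(mem_support_initialForm h).mp (Finset.max'_mem _ hne), le_valr_iff.mp h.symm.le, ?_⟩
  intro u hu
  refine lt_of_le_of_ne (le_valr_iff.mp h.symm.le u) fun he => ?_
  exact absurd (Finset.le_max' _ u ((mem_support_initialForm h).mpr he.symm)) (not_le.mpr hu)

lemma exists_hasLead {f : KXr K r} (hf : f ≠ 0) : ∃ v : ℝ, HasLead f v (lm f.initialForm) :=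
  (exists_valr_eq hf).imp fun _ => hasLead

lemma HasLead.coeff_ne_zero {f : KXr K r} {v : ℝ} {m : Mon n} (h : HasLead f v m) :
    f.coeff m ≠ 0 := by
  intro h0
  have := h.coeffVal_eq
  rw [coeffVal, h0, termVal_zero] at this
  exact WithTop.top_ne_coe this

lemma HasLead.lc_eq {f : KXr K r} {v : ℝ} {m : Mon n} (h : HasLead f v m) :
    lc f.initialForm = f.coeff m := by
  rw [lc, h.lm_eq, initialForm_coeff_of_coeffVal_eq (h.coeffVal_eq.trans h.valr_eq.symm)]

lemma HasLead.const_mul {f : KXr K r} {v c : ℝ} {m : Mon n} (h : HasLead f v m) {a : K}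
    (ha : val a = c) : HasLead (term r a 0 * f) (c + v) m := by
  have hc : termVal r a 0 = c := by simp [termVal, ha, dot_zero]
  refine ⟨?_, fun u => ?_, fun u hu => ?_⟩ <;>
    rw [coeffVal_term_mul, hc, sub_zero, WithTop.coe_add]
  · rw [h.coeffVal_eq]
  · exact add_le_add_right (h.le_coeffVal u) _
  · exact (WithTop.add_lt_add_iff_left WithTop.coe_ne_top).mpr (h.lt_coeffVal u hu)

/-- The series all of whose terms have valuation at least `v`, and greater than `v` for the
exponents from `m` on. -/
def below (r : Fin n → ℚ) (v : ℝ) (m : Mon n) : AddSubgroup (KXr K r) where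
  carrier := {f | ∀ u, (v : WithTop ℝ) ≤ coeffVal f u ∧ (m ≤ u → (v : WithTop ℝ) < coeffVal f u)}
  zero_mem' := fun u => by
    rw [coeffVal_zero]
    exact ⟨le_top, fun _ => WithTop.coe_lt_top v⟩
  add_mem' := fun {f g} hf hg u =>
    ⟨(le_min (hf u).1 (hg u).1).trans (min_coeffVal_le_add f g u), fun hu =>
      (lt_min ((hf u).2 hu) ((hg u).2 hu)).trans_le (min_coeffVal_le_add f g u)⟩
  neg_mem' := fun {f} hf u => by
    rw [coeffVal_neg]
    exact hf u

lemma valGt_le_below {v N : ℝ} (h : v ≤ N) (m : Mon n) :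
    (valGt r N : AddSubgroup (KXr K r)) ≤ below r v m := fun _ hf u =>
  have := (WithTop.coe_le_coe.mpr h).trans_lt (lt_valr_iff.mp hf u)
  ⟨this.le, fun _ => this⟩

/-- Membership in `below` depends only on the level of the series, so these subgroups are the strict
initial segments for the order on levels. -/
lemma HasLead.mem_below_iff {f : KXr K r} {v v' : ℝ} {m m' : Mon n} (h : HasLead f v' m') :
    f ∈ below r v m ↔ v < v' ∨ v = v' ∧ m' < m := by
  constructor
  · intro hf
    rcases (WithTop.coe_le_coe.mp ((hf m').1.trans_eq h.coeffVal_eq)).lt_or_eq with h1 | rfl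
    · exact Or.inl h1
    · refine Or.inr ⟨rfl, lt_of_not_ge fun hle => ?_⟩
      exact ((hf m').2 hle).ne' h.coeffVal_eq
  · rintro (h1 | ⟨rfl, h1⟩) u
    · have := (WithTop.coe_lt_coe.mpr h1).trans_le (h.le_coeffVal u)
      exact ⟨this.le, fun _ => this⟩
    · exact ⟨h.le_coeffVal u, fun hu => h.lt_coeffVal u (h1.trans_le hu)⟩

lemma HasLead.mem_below_of_le {f g : KXr K r} {v v' : ℝ} {m m' : Mon n} (h : HasLead f v' m')
    (hg : HasLead g v' m') (hf : f ∈ below r v m) : g ∈ below r v m :=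
  hg.mem_below_iff.mpr (h.mem_below_iff.mp hf)

lemma HasLead.add_below {f g : KXr K r} {v : ℝ} {m : Mon n} (h : HasLead f v m)
    (hg : g ∈ below r v m) : HasLead (f + g) v m := by
  refine ⟨?_, fun u => ?_, fun u hu => ?_⟩
  · rw [coeffVal_add_eq_of_lt, h.coeffVal_eq]
    rw [h.coeffVal_eq]
    exact (hg m).2 le_rfl
  · exact (le_min (h.le_coeffVal u) (hg u).1).trans (min_coeffVal_le_add f g u)
  · exact (lt_min (h.lt_coeffVal u hu) ((hg u).2 hu.le)).trans_le (min_coeffVal_le_add f g u)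

/-- Series with the same leading term differ by smaller terms. -/
lemma HasLead.sub_mem_below {f g : KXr K r} {v : ℝ} {m : Mon n} (hf : HasLead f v m)
    (hg : HasLead g v m) (h : f.coeff m = g.coeff m) : f - g ∈ below r v m := by
  have hle : ∀ u, (v : WithTop ℝ) ≤ coeffVal (f - g) u := fun u => by
    rw [sub_eq_add_neg]
    refine (le_min (hf.le_coeffVal u) ?_).trans (min_coeffVal_le_add f (-g) u)
    rw [coeffVal_neg]
    exact hg.le_coeffVal u
  refine fun u => ⟨hle u, fun hu => ?_⟩
  rcases hu.lt_or_eq with hu | rfl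
  · rw [sub_eq_add_neg]
    refine (lt_min (hf.lt_coeffVal u hu) ?_).trans_le (min_coeffVal_le_add f (-g) u)
    rw [coeffVal_neg]
    exact hg.lt_coeffVal u hu
  · rw [coeffVal, coeff_sub, h, sub_self, termVal_zero]
    exact WithTop.coe_lt_top v

lemma const_mul_mem_below {f : KXr K r} {v c : ℝ} {m : Mon n} (h : f ∈ below r v m) {a : K}
    (ha : (c : WithTop ℝ) ≤ val a) : term r a 0 * f ∈ below r (c + v) m := by
  have hc : (c : WithTop ℝ) ≤ termVal r a 0 := by simpa [termVal, dot_zero] using ha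
  intro u
  rw [coeffVal_term_mul, sub_zero, WithTop.coe_add]
  refine ⟨add_le_add hc (h u).1, fun hu => ?_⟩
  exact ((WithTop.add_lt_add_iff_left WithTop.coe_ne_top).mpr ((h u).2 hu)).trans_le
    (add_le_add_left hc _)

end KXr

end Leading

end LaurentGB

namespace LaurentGB

open Filter Topology KXr
open scoped Pointwise

/-! ### Dickson's lemma -/

section Dickson

/-- Dickson's lemma in a finitely generated commutative monoid. -/
lemma exists_lt_add_eq_of_fg {M : Type*} [AddCommMonoid M] {P : AddSubmonoid M} (hP : P.FG)
    {w : ℕ → M} (hw : ∀ k, w k ∈ P) : ∃ j k, j < k ∧ ∃ s ∈ P, s + w j = w k := by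
  obtain ⟨S, rfl⟩ := hP
  choose a ha using fun k => AddSubmonoid.mem_closure_finset'.mp (hw k)
  -- The vectors of exponents with respect to the generators are well quasi-ordered componentwise.
  obtain ⟨j, k, hjk, hle⟩ := wellQuasiOrdered_le (α := S → ℕ) a
  refine ⟨j, k, hjk, ∑ i : S, (a k i - a j i) • i.1, ?_, ?_⟩
  · exact sum_mem fun i _ => nsmul_mem (AddSubmonoid.subset_closure i.2) _
  · rw [ha j, ha k, ← Finset.sum_add_distrib]
    refine Finset.sum_congr rfl fun i _ => ?_
    rw [← add_nsmul, Nat.sub_add_cancel (hle i)]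

/-- A subset of a finitely generated commutative monoid stable under translations is generated by
a finite set. -/
lemma exists_finset_add_eq_of_fg {M : Type*} [AddCommMonoid M] {P : AddSubmonoid M} (hP : P.FG)
    {W : Set M} (hW : W ⊆ P) (hadd : ∀ s ∈ P, ∀ w ∈ W, s + w ∈ W) :
    ∃ U : Finset M, (P : Set M) + (U : Set M) = W := by
  by_contra! hU
  -- If no finite set generates W, a sequence can be chosen greedily with no term in the translates
  -- of an earlier one.
  obtain ⟨w, hw, hlt⟩ := exists_seq_of_forall_finset_exists (fun x => x ∈ W)
    (fun x y => ∀ s ∈ P, s + x ≠ y) (fun U hUW => by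
      by_contra! hcon
      refine hU U (Set.Subset.antisymm ?_ fun y hy => ?_)
      · rintro _ ⟨s, hs, x, hx, rfl⟩
        exact hadd s hs x (hUW x hx)
      · obtain ⟨x, hx, s, hs, rfl⟩ := hcon y hy
        exact Set.add_mem_add hs hx)
  obtain ⟨j, k, hjk, s, hs, h⟩ := exists_lt_add_eq_of_fg hP fun k => hW (hw k)
  exact hlt j k hjk s hs h

end Dickson

/-! ### Conic decompositions -/

section Cones

variable {n : ℕ} {I : Type*} {T : I → AddSubmonoid (Mon n)}

lemma IsConicDecomposition.exists_mem (hT : IsConicDecomposition T) (w : Mon n) : ∃ i, w ∈ T i := by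
  have : w ∈ ⋃ i, (T i : Set (Mon n)) := hT.iUnion_eq_univ ▸ Set.mem_univ w
  simpa using this

/-- Dickson's lemma for a conic decomposition. -/
lemma IsConicDecomposition.exists_lt_add_eq [Finite I] (hT : IsConicDecomposition T)
    (w : ℕ → Mon n) : ∃ j k i, j < k ∧ w j ∈ T i ∧ ∃ s ∈ T i, s + w j = w k := by
  choose c hc using fun k => hT.exists_mem (w k)
  -- There are finitely many cones, so one of them contains infinitely many terms of the sequence.
  obtain ⟨i, hi⟩ := Finite.exists_infinite_fiber c
  have hinf : {k | c k = i}.Infinite := Set.infinite_coe_iff.mp hi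
  obtain ⟨φ, hφ, hc'⟩ := extraction_of_frequently_atTop (Nat.frequently_atTop_iff_infinite.mpr hinf)
  have hw : ∀ k, w (φ k) ∈ T i := fun k => hc' k ▸ hc (φ k)
  obtain ⟨j, k, hjk, h⟩ := exists_lt_add_eq_of_fg (hT.fg i) hw
  exact ⟨φ j, φ k, i, hφ hjk, hw j, h⟩

/-- In a sequence some later term is s + w_j, with s and w_j in one cone. As 0 ≤ s, compatibility in
that cone gives w_j ≤ s + w_j, so the sequence is not strictly decreasing. -/
lemma IsConicDecomposition.wellFoundedLT [Finite I] [LinearOrder (Mon n)]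
    (hT : IsConicDecomposition T) (hord : IsGMO T) : WellFoundedLT (Mon n) := by
  refine ⟨wellFounded_iff_isEmpty_descending_chain.mpr ⟨fun ⟨w, hw⟩ => ?_⟩⟩
  obtain ⟨j, k, i, hjk, hj, s, hs, h⟩ := hT.exists_lt_add_eq w
  have hlt : w k < w j := strictAnti_nat_of_succ_lt hw hjk
  refine absurd hlt (not_lt.mpr ?_)
  rcases (hord.zero_le s).eq_or_lt with rfl | h0
  · rw [← h, zero_add]
  · have := hord.add_lt_add s (w j) 0 i hs hj h0
    rw [zero_add, h] at this
    exact this.le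

/-- Since T_i generates the group, each u is a difference of two elements of T_i. The sum of the
elements subtracted works for all u in F at once. -/
lemma IsConicDecomposition.exists_forall_add_mem (hT : IsConicDecomposition T) (i : I)
    (F : Finset (Mon n)) : ∃ t, ∀ u ∈ F, t + u ∈ T i := by
  have h1 : ∀ u : Mon n, ∃ b ∈ T i, b + u ∈ T i := by
    intro u
    have hu : u ∈ AddSubgroup.closure (T i : Set (Mon n)) := hT.closure_eq_top i ▸ trivial
    induction hu using AddSubgroup.closure_induction with
    | mem u hu => exact ⟨0, zero_mem _, by rwa [zero_add]⟩
    | zero => exact ⟨0, zero_mem _, by rw [zero_add]; exact zero_mem _⟩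
    | add u v _ _ hu hv =>
      obtain ⟨b, hb, hbu⟩ := hu
      obtain ⟨c, hc, hcv⟩ := hv
      exact ⟨b + c, add_mem hb hc, add_add_add_comm b c u v ▸ add_mem hbu hcv⟩
    | neg u _ hu =>
      obtain ⟨b, hb, hbu⟩ := hu
      exact ⟨b + u, hbu, by rwa [add_neg_cancel_right]⟩
  classical
  suffices ∃ t ∈ T i, ∀ u ∈ F, t + u ∈ T i from this.imp fun _ h => h.2
  induction F using Finset.induction_on with
  | empty => exact ⟨0, zero_mem _, by simp⟩
  | insert a F _ ih =>
    obtain ⟨t, ht, htF⟩ := ih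
    obtain ⟨b, hb, hba⟩ := h1 a
    refine ⟨b + t, add_mem hb ht, fun u hu => ?_⟩
    rcases Finset.mem_insert.mp hu with rfl | hu
    · rw [add_right_comm]
      exact add_mem hba ht
    · rw [add_assoc]
      exact add_mem hb (htF u hu)

end Cones

/-! ### Multiplication by terms -/

section Terms

variable {K : Type*} [Field K] [CompleteDVField K] {n : ℕ} {r : Fin n → ℚ}

lemma termVal_one (t : Mon n) : termVal r (1 : K) t = ((-dot r t : ℝ) : WithTop ℝ) := by
  rw [termVal, val_one, zero_add]

lemma KXr.term_mul_ne_zero {a : K} (ha : a ≠ 0) (w : Mon n) {f : KXr K r} (hf : f ≠ 0) :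
    term r a w * f ≠ 0 := by
  obtain ⟨c, hc⟩ := exists_termVal_eq (r := r) ha w
  obtain ⟨v, hv⟩ := exists_valr_eq hf
  refine ne_zero_of_valr_eq (v := c + v) ?_
  rw [valr_term_mul, hc, hv, WithTop.coe_add]

lemma term_mul_eq_const_mul (c : K) (w : Mon n) (f : KXr K r) :
    term r c w * f = term r c 0 * (term r 1 w * f) := by
  rw [← mul_assoc, term_mul_term, mul_one, zero_add]

lemma exists_val_eq {c : K} (hc : c ≠ 0) : ∃ γ : ℝ, val c = γ := by
  obtain ⟨γ, hγ⟩ := WithTop.ne_top_iff_exists.mp (mt val_eq_top_iff.mp hc)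
  exact ⟨γ, hγ.symm⟩

end Terms

/-! ### Leading monomials relative to a cone -/

section LeadingCones

variable {K : Type*} [Field K] [CompleteDVField K] {n : ℕ} {r : Fin n → ℚ} {I : Type*}
  {T : I → AddSubmonoid (Mon n)} [LinearOrder (Mon n)]

/-- Only m and s must lie in the cone; u is arbitrary. Hence a leading monomial in T_i can be
compared with exponents outside T_i, which makes it stay leading under translation by T_i. -/
lemma IsGMO.lt_add (hord : IsGMO T) {i : I} {s m : Mon n} (hm : m ∈ T i)
    (hs : s ∈ T i) {u : Mon n} (hu : u - s < m) : u < s + m := by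
  have := hord.add_lt_add m s (u - s) i hm hs hu
  rwa [sub_add_cancel, add_comm] at this

lemma KXr.HasLead.shift (hord : IsGMO T) {f : KXr K r} {v : ℝ} {m s : Mon n} {i : I}
    (h : HasLead f v m) (hm : m ∈ T i) (hs : s ∈ T i) :
    HasLead (term r 1 s * f) (-dot r s + v) (s + m) := by
  refine ⟨?_, fun u => ?_, fun u hu => ?_⟩ <;> rw [coeffVal_term_mul, termVal_one, WithTop.coe_add]
  · rw [add_sub_cancel_left, h.coeffVal_eq]
  · exact add_le_add_right (h.le_coeffVal _) _
  · refine (WithTop.add_lt_add_iff_left WithTop.coe_ne_top).mpr (h.lt_coeffVal _ ?_)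
    rcases lt_trichotomy (u - s) m with h1 | h1 | h1
    · exact absurd (hord.lt_add hm hs h1) (not_lt.mpr hu.le)
    · exact absurd (by rw [← h1, add_sub_cancel]) hu.ne
    · exact h1

lemma KXr.shift_mem_below (hord : IsGMO T) {f : KXr K r} {v : ℝ} {m s : Mon n} {i : I}
    (h : f ∈ below r v m) (hm : m ∈ T i) (hs : s ∈ T i) :
    term r 1 s * f ∈ below r (-dot r s + v) (s + m) := by
  intro u
  rw [coeffVal_term_mul, termVal_one, WithTop.coe_add]
  refine ⟨add_le_add_right (h _).1 _, fun hu => ?_⟩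
  refine (WithTop.add_lt_add_iff_left WithTop.coe_ne_top).mpr ((h _).2 ?_)
  by_contra! hlt
  exact absurd (hord.lt_add hm hs hlt) (not_lt.mpr hu)

lemma mem_shifts {i : I} {f : KXr K r} {t : Mon n} :
    t ∈ shifts T i f.initialForm ↔ lm (term r 1 t * f).initialForm ∈ T i := by
  rw [initialForm_term_mul]
  exact Iff.rfl

lemma lm_shift_add (hord : IsGMO T) {i : I} {f : KXr K r} (hf : f ≠ 0) {s t : Mon n}
    (hs : s ∈ T i) (ht : lm (term r 1 t * f).initialForm ∈ T i) :
    lm (term r 1 (s + t) * f).initialForm = s + lm (term r 1 t * f).initialForm := by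
  obtain ⟨v, hv⟩ := exists_hasLead (term_mul_ne_zero one_ne_zero t hf)
  have := (hv.shift hord ht hs).lm_eq
  rwa [← mul_assoc, term_mul_term, one_mul] at this

/-- The definition of lm_i does not depend on the shift: s and t have a common translate by elements
of T_i, namely b + t = (b + (t - s)) + s, and such translations carry leading monomials along. -/
lemma lm_shift_sub_eq (hT : IsConicDecomposition T) (hord : IsGMO T) {i : I} {f : KXr K r}
    (hf : f ≠ 0) {s t : Mon n} (hs : lm (term r 1 s * f).initialForm ∈ T i)
    (ht : lm (term r 1 t * f).initialForm ∈ T i) :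
    lm (term r 1 s * f).initialForm - s = lm (term r 1 t * f).initialForm - t := by
  obtain ⟨b, hb⟩ := hT.exists_forall_add_mem i {0, t - s}
  have hb0 : b ∈ T i := by simpa using hb 0 (by simp)
  have hbt : b + (t - s) ∈ T i := hb _ (by simp)
  have h1 := lm_shift_add hord hf hbt hs
  have h2 := lm_shift_add hord hf hb0 ht
  rw [add_assoc, sub_add_cancel, h2, add_assoc, add_left_cancel_iff] at h1
  rw [h1]
  generalize lm (term r 1 s * f).initialForm = p
  abel

lemma coeffVal_lm_shift_sub {f : KXr K r} (hf : f ≠ 0) (t : Mon n) :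
    coeffVal f (lm (term r 1 t * f).initialForm - t) = f.valr := by
  obtain ⟨v, hv⟩ := exists_hasLead (term_mul_ne_zero one_ne_zero t hf)
  have h1 := hv.valr_eq
  rw [← hv.coeffVal_eq, coeffVal_term_mul, valr_term_mul, termVal_one] at h1
  exact ((WithTop.add_left_inj WithTop.coe_ne_top).mp h1).symm

/-- A translation can move the whole finite support of in_r(f) into T_i. The leading monomial of the
translate comes from this support. -/
lemma exists_mem_shifts (hT : IsConicDecomposition T) (i : I) {f : KXr K r} (hf : f ≠ 0) :
    (shifts T i f.initialForm).Nonempty := by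
  obtain ⟨v, hv⟩ := exists_valr_eq hf
  obtain ⟨t, ht⟩ := hT.exists_forall_add_mem i f.initialForm.coeff.support
  refine ⟨t, mem_shifts.mpr ?_⟩
  have := ht _ ((mem_support_initialForm hv).mpr ((coeffVal_lm_shift_sub hf t).trans hv))
  rwa [add_sub_cancel] at this

lemma lmCone_eq (hT : IsConicDecomposition T) (hord : IsGMO T) {i : I} {f : KXr K r}
    (hf : f ≠ 0) {t : Mon n} (ht : lm (term r 1 t * f).initialForm ∈ T i) :
    lmCone T i f.initialForm = lm (term r 1 t * f).initialForm - t := by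
  have hne := exists_mem_shifts hT i hf
  rw [lmCone, dif_pos hne, ← initialForm_term_mul]
  exact lm_shift_sub_eq hT hord hf (mem_shifts.mp hne.some_mem) ht

lemma coeffVal_lmCone (hT : IsConicDecomposition T) (hord : IsGMO T) (i : I) {f : KXr K r}
    (hf : f ≠ 0) : coeffVal f (lmCone T i f.initialForm) = f.valr := by
  obtain ⟨t, ht⟩ := exists_mem_shifts hT i hf
  rw [lmCone_eq hT hord hf (mem_shifts.mp ht), coeffVal_lm_shift_sub hf]

lemma lcCone_eq (hT : IsConicDecomposition T) (hord : IsGMO T) (i : I) {f : KXr K r}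
    (hf : f ≠ 0) : lcCone T i f.initialForm = f.coeff (lmCone T i f.initialForm) :=
  initialForm_coeff_of_coeffVal_eq (coeffVal_lmCone hT hord i hf)

lemma termVal_lcCone (hT : IsConicDecomposition T) (hord : IsGMO T) (i : I) {f : KXr K r}
    (hf : f ≠ 0) : termVal r (lcCone T i f.initialForm) (lmCone T i f.initialForm) = f.valr := by
  rw [lcCone_eq hT hord i hf]
  exact coeffVal_lmCone hT hord i hf

lemma lcCone_ne_zero (hT : IsConicDecomposition T) (hord : IsGMO T) (i : I) {f : KXr K r}
    (hf : f ≠ 0) : lcCone T i f.initialForm ≠ 0 := by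
  intro h
  have := termVal_lcCone hT hord i hf
  rw [h, termVal_zero, eq_comm, valr_eq_top_iff] at this
  exact hf this

/-- This eliminates the choice made in `lmCone`. Stability under T_i and the union over all cones
are then read off from leading monomials of translates. -/
lemma mem_leadSet_iff (hT : IsConicDecomposition T) (hord : IsGMO T) {i : I} {f : KXr K r}
    (hf : f ≠ 0) {w : Mon n} :
    w ∈ leadSet T i f ↔ w ∈ T i ∧ ∃ t, lm (term r 1 t * f).initialForm = w := by
  constructor
  · rintro ⟨t, ht, rfl⟩
    have ht := mem_shifts.mp ht
    rw [lmCone_eq hT hord hf ht, sub_add_cancel]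
    exact ⟨ht, t, rfl⟩
  · rintro ⟨hw, t, rfl⟩
    exact ⟨t, mem_shifts.mpr hw, by rw [lmCone_eq hT hord hf hw, sub_add_cancel]⟩

lemma lm_shift_sub_lmCone (hT : IsConicDecomposition T) (hord : IsGMO T) {i : I} {f : KXr K r}
    (hf : f ≠ 0) {w : Mon n} (hw : w ∈ leadSet T i f) :
    lm (term r 1 (w - lmCone T i f.initialForm) * f).initialForm = w := by
  obtain ⟨h1, t, rfl⟩ := (mem_leadSet_iff hT hord hf).mp hw
  rw [lmCone_eq hT hord hf h1, sub_sub_cancel]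

lemma add_mem_leadSet (hT : IsConicDecomposition T) (hord : IsGMO T) {i : I} {f : KXr K r}
    (hf : f ≠ 0) {s w : Mon n} (hs : s ∈ T i) (hw : w ∈ leadSet T i f) :
    s + w ∈ leadSet T i f := by
  rw [mem_leadSet_iff hT hord hf] at *
  obtain ⟨h1, t, rfl⟩ := hw
  exact ⟨add_mem hs h1, s + t, lm_shift_add hord hf hs h1⟩

lemma mem_iUnion_leadSet_iff (hT : IsConicDecomposition T) (hord : IsGMO T) {f : KXr K r}
    (hf : f ≠ 0) {w : Mon n} :
    w ∈ ⋃ i, leadSet T i f ↔ ∃ t, lm (term r 1 t * f).initialForm = w := by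
  simp only [Set.mem_iUnion, mem_leadSet_iff hT hord hf]
  exact ⟨fun ⟨_, _, h⟩ => h, fun h => (hT.exists_mem w).imp fun _ hi => ⟨hi, h⟩⟩

/-- The test does not require lm(f) to lie in T_i. This implication suffices: when every test fails,
lm(f) lies in no leading set. -/
lemma reduces_of_mem_leadSet (hT : IsConicDecomposition T) (hord : IsGMO T) {i : I}
    {f g : KXr K r} (hg : g ≠ 0) (h : lm f.initialForm ∈ leadSet T i g) : Reduces T i g f :=
  lm_shift_sub_lmCone hT hord hg h

/-- Both leading sets are stable under translation by the finitely generated monoid T_i, so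
Dickson's lemma applies to their intersection. -/
lemma exists_isGeneratingSet (hT : IsConicDecomposition T) (hord : IsGMO T) (i : I)
    {f g : KXr K r} (hf : f ≠ 0) (hg : g ≠ 0) : ∃ U, IsGeneratingSet T i f g U :=
  exists_finset_add_eq_of_fg (hT.fg i)
    (fun _ hw => ((mem_leadSet_iff hT hord hf).mp hw.1).1)
    fun _ hs _ hw => ⟨add_mem_leadSet hT hord hf hs hw.1, add_mem_leadSet hT hord hg hs hw.2⟩

lemma IsGeneratingSet.subset {i : I} {f g : KXr K r} {U : Finset (Mon n)}
    (h : IsGeneratingSet T i f g U) {v : Mon n} (hv : v ∈ U) :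
    v ∈ leadSet T i f ∩ leadSet T i g := by
  have : (0 : Mon n) + v ∈ (T i : Set (Mon n)) + (U : Set (Mon n)) :=
    Set.add_mem_add (zero_mem (T i)) hv
  rwa [zero_add, h] at this

lemma lm_term_mul {c : K} (hc : c ≠ 0) (w : Mon n) {f : KXr K r} (hf : f ≠ 0) :
    lm (term r c w * f).initialForm = lm (term r 1 w * f).initialForm := by
  obtain ⟨v, hv⟩ := exists_hasLead (term_mul_ne_zero one_ne_zero w hf)
  obtain ⟨γ, hγ⟩ := exists_val_eq hc
  rw [term_mul_eq_const_mul]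
  exact (hv.const_mul hγ).lm_eq

lemma KXr.HasLead.term_mul_ne {c : K} {w m : Mon n} {f : KXr K r} {β : ℝ}
    (h : HasLead (term r c w * f) β m) : c ≠ 0 ∧ f ≠ 0 := by
  have h0 := h.ne_zero
  constructor
  · rintro rfl
    exact h0 (by rw [term_zero, zero_mul])
  · rintro rfl
    exact h0 (by rw [mul_zero])

lemma KXr.HasLead.lmCone_eq_sub (hT : IsConicDecomposition T) (hord : IsGMO T) {c : K}
    {w m : Mon n} {f : KXr K r} {β : ℝ} (h : HasLead (term r c w * f) β m) {i : I}
    (hm : m ∈ T i) : lmCone T i f.initialForm = m - w := by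
  obtain ⟨hc, hf⟩ := h.term_mul_ne
  have hlm := (lm_term_mul hc w hf).symm.trans h.lm_eq
  rw [lmCone_eq hT hord hf (t := w) (hlm ▸ hm), hlm]

lemma KXr.HasLead.mem_leadSet (hT : IsConicDecomposition T) (hord : IsGMO T) {c : K}
    {w m : Mon n} {f : KXr K r} {β : ℝ} (h : HasLead (term r c w * f) β m) {i : I}
    (hm : m ∈ T i) : m ∈ leadSet T i f := by
  obtain ⟨hc, hf⟩ := h.term_mul_ne
  exact (mem_leadSet_iff hT hord hf).mpr ⟨hm, w, (lm_term_mul hc w hf).symm.trans h.lm_eq⟩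

end LeadingCones

end LaurentGB

namespace LaurentGB

open Filter Topology KXr
open scoped Pointwise

/-! ### Finiteness of the valuations below a bound -/

section ValueSets

/-- The real numbers at most `N` obtained from a finite set `V` by adding elements of a finite set
`A` of nonnegative reals are finite in number. -/
lemma exists_finite_add_closed {V A : Set ℝ} (hV : V.Finite) (hA : A.Finite)
    (hA0 : ∀ a ∈ A, 0 ≤ a) (N : ℝ) : ∃ E : Set ℝ, E.Finite ∧ (∀ e ∈ E, e ≤ N) ∧
      (∀ v ∈ V, v ≤ N → v ∈ E) ∧ ∀ e ∈ E, ∀ a ∈ A, e + a ≤ N → e + a ∈ E := by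
  induction A, hA using Set.Finite.induction_on with
  | empty =>
    exact ⟨{v ∈ V | v ≤ N}, hV.subset (Set.sep_subset _ _), fun e he => he.2,
      fun v hv h => ⟨hv, h⟩, by simp⟩
  | @insert a A _ _ ih =>
    obtain ⟨E, hE, hEN, hVE, hEA⟩ := ih fun b hb => hA0 b (Set.mem_insert_of_mem a hb)
    rcases (hA0 a (Set.mem_insert a A)).eq_or_lt with rfl | ha
    · refine ⟨E, hE, hEN, hVE, fun e he b hb h => ?_⟩
      rcases Set.mem_insert_iff.mp hb with rfl | hb
      · rwa [add_zero]
      · exact hEA e he b hb h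
    -- All multiples of the new increment a > 0 are added at once. Since E is bounded below and the
    -- results are at most N, only finitely many multiples matter.
    refine ⟨{x | x ≤ N ∧ ∃ e ∈ E, ∃ k : ℕ, x = e + k * a}, ?_, fun e he => he.1,
      fun v hv h => ⟨h, v, hVE v hv h, 0, by simp⟩, ?_⟩
    · obtain ⟨b, hb⟩ := hE.bddBelow
      obtain ⟨k₀, hk₀⟩ := exists_nat_gt ((N - b) / a)
      refine (Set.Finite.image2 (fun (e : ℝ) (k : ℕ) => e + k * a) hE
        (Set.finite_Iio k₀)).subset ?_
      rintro x ⟨hx, e, he, k, rfl⟩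
      refine ⟨e, he, k, ?_, rfl⟩
      rw [div_lt_iff₀ ha] at hk₀
      have h1 : (k : ℝ) * a < k₀ * a := by linarith [hb he]
      exact_mod_cast lt_of_mul_lt_mul_right h1 ha.le
    · rintro _ ⟨-, e, he, k, rfl⟩ c hc h
      refine ⟨h, ?_⟩
      rcases Set.mem_insert_iff.mp hc with rfl | hc
      · exact ⟨e, he, k + 1, by push_cast; ring⟩
      · refine ⟨e + c, hEA e he c hc ?_, k, by ring⟩
        have : 0 ≤ (k : ℝ) * a := by positivity
        linarith

lemma exists_finite_forall_of_mono {ι : Type*} {s : Set ι} (hs : s.Finite)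
    {P : ι → Set ℝ → Prop} (hP : ∀ i A B, A ⊆ B → P i A → P i B)
    (h : ∀ i ∈ s, ∃ A : Set ℝ, A.Finite ∧ (∀ a ∈ A, 0 ≤ a) ∧ P i A) :
    ∃ A : Set ℝ, A.Finite ∧ (∀ a ∈ A, 0 ≤ a) ∧ ∀ i ∈ s, P i A := by
  choose! A hA hA0 hAP using h
  refine ⟨⋃ i ∈ s, A i, hs.biUnion hA, fun a ha => ?_, fun i hi =>
    hP i _ _ (Set.subset_biUnion_of_mem hi) (hAP i hi)⟩
  obtain ⟨i, hi, ha⟩ := Set.mem_iUnion₂.mp ha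
  exact hA0 i hi a ha

lemma exists_finite_subset_mem_closure {G : Type*} [AddGroup G] {S : Set G} {x : G}
    (hx : x ∈ AddSubgroup.closure S) : ∃ Y ⊆ S, Y.Finite ∧ x ∈ AddSubgroup.closure Y := by
  induction hx using AddSubgroup.closure_induction with
  | mem x hx =>
    exact ⟨{x}, Set.singleton_subset_iff.mpr hx, Set.finite_singleton x,
      AddSubgroup.subset_closure rfl⟩
  | zero => exact ⟨∅, Set.empty_subset _, Set.finite_empty, zero_mem _⟩
  | add x y _ _ hx hy =>
    obtain ⟨Y, hY, hYf, hxY⟩ := hx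
    obtain ⟨Z, hZ, hZf, hyZ⟩ := hy
    exact ⟨Y ∪ Z, Set.union_subset hY hZ, hYf.union hZf,
      add_mem (AddSubgroup.closure_mono Set.subset_union_left hxY)
        (AddSubgroup.closure_mono Set.subset_union_right hyZ)⟩
  | neg x _ hx =>
    obtain ⟨Y, hY, hYf, hxY⟩ := hx
    exact ⟨Y, hY, hYf, neg_mem hxY⟩

/-- The values of the valuation are the multiples of a positive real number. -/
lemma exists_val_step (K : Type*) [Field K] [CompleteDVField K] :
    ∃ ϖ : ℝ, 0 < ϖ ∧ ∀ (x y : K) (a b : ℝ), val x = a → val y = b → a ≤ b →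
      ∃ k : ℕ, b = a + k * ϖ := by
  obtain ⟨p, hp0, hp, hmin⟩ := CompleteDVField.exists_uniformizer (K := K)
  obtain ⟨ϖ, hϖ⟩ := exists_val_eq hp0
  have hϖ' : CompleteDVField.val p = (ϖ : WithTop ℝ) := hϖ
  have hpos : 0 < ϖ := by
    rw [hϖ'] at hp
    exact_mod_cast hp
  refine ⟨ϖ, hpos, ?_⟩
  have hsub : ∀ (x y : K) (a b : ℝ), val x = a → val y = b → val (y / x) = (b - a : ℝ) := by
    intro x y a b hx hy
    have hx0 : x ≠ 0 := by
      rintro rfl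
      rw [val_zero] at hx
      exact WithTop.top_ne_coe hx
    have h := val_mul (y / x) x
    rw [div_mul_cancel₀ _ hx0, hx, hy] at h
    refine WithTop.add_right_cancel (z := (a : WithTop ℝ)) WithTop.coe_ne_top ?_
    rw [← h, ← WithTop.coe_add, sub_add_cancel]
  -- Euclidean division by ϖ: a positive valuation is at least ϖ, and dividing by the uniformizer
  -- lowers it by ϖ.
  suffices ∀ (k : ℕ) (x : K) (a : ℝ), val x = a → 0 ≤ a → a < k * ϖ → ∃ l : ℕ, a = l * ϖ by
    intro x y a b hx hy hab
    obtain ⟨k, hk⟩ := exists_nat_gt ((b - a) / ϖ)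
    rw [div_lt_iff₀ hpos] at hk
    obtain ⟨l, hl⟩ := this k (y / x) (b - a) (hsub x y a b hx hy) (sub_nonneg.mpr hab) hk
    exact ⟨l, by linarith⟩
  intro k
  induction k with
  | zero =>
    intro x a _ h0 h1
    simp only [Nat.cast_zero, zero_mul] at h1
    exact absurd h1 (not_lt.mpr h0)
  | succ k ih =>
    intro x a hx h0 h1
    rcases h0.eq_or_lt with rfl | h0
    · exact ⟨0, by simp⟩
    have hle : ϖ ≤ a := by
      have := hmin x (by
        show 0 < val x
        rw [hx]
        exact_mod_cast h0)
      rw [hϖ'] at this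
      exact WithTop.coe_le_coe.mp (this.trans_eq hx)
    obtain ⟨l, hl⟩ := ih (x / p) (a - ϖ) (hsub p x ϖ a hϖ hx) (sub_nonneg.mpr hle) (by
      push_cast at h1
      linarith)
    exact ⟨l + 1, by push_cast; linarith⟩

lemma add_nat_mul_mem {E : Set ℝ} {N ϖ : ℝ} (hϖ : 0 < ϖ)
    (hE : ∀ e ∈ E, e + ϖ ≤ N → e + ϖ ∈ E) {e : ℝ} (he : e ∈ E) (k : ℕ) (h : e + k * ϖ ≤ N) :
    e + k * ϖ ∈ E := by
  induction k with
  | zero => simpa using he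
  | succ k ih =>
    push_cast at h ⊢
    rw [add_mul, one_mul, ← add_assoc] at h ⊢
    exact hE _ (ih (by linarith)) h

/-- Levels are compared by the valuation, in decreasing order, and then by the exponent. -/
lemma wellFounded_level {α : Type*} [LinearOrder α] [WellFoundedLT α] {E : Set ℝ}
    (hE : E.Finite) : WellFounded fun p q : E × α =>
      (q.1 : ℝ) < p.1 ∨ (q.1 : ℝ) = p.1 ∧ p.2 < q.2 := by
  have : Finite E := hE
  have h1 : WellFounded (fun a b : E => b < a) := wellFounded_gt
  refine Subrelation.wf (r := Prod.Lex (fun a b : E => b < a) (fun a b : α => a < b)) ?_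
    (WellFounded.prod_lex h1 wellFounded_lt)
  rintro ⟨a, m⟩ ⟨b, l⟩ (h | ⟨h, h'⟩)
  · exact Prod.Lex.left _ _ h
  · obtain rfl : b = a := Subtype.ext h
    exact Prod.Lex.right _ h'

end ValueSets

/-! ### Convergence and properties of the division -/

section Division

variable {K : Type*} [Field K] [CompleteDVField K] {n : ℕ} {r : Fin n → ℚ}

namespace KXr

lemma finite_coeffVal_le (f : KXr K r) (N : ℝ) :
    {v : ℝ | v ≤ N ∧ ∃ u, coeffVal f u = v}.Finite := by
  refine ((f.conv (N + 1)).image fun u => (coeffVal f u).untopD 0).subset ?_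
  rintro v ⟨hv, u, hu⟩
  refine ⟨u, fun h => ?_, by simp [hu]⟩
  have h2 : ((N + 1 : ℝ) : WithTop ℝ) ≤ (v : ℝ) := hu ▸ h
  linarith [WithTop.coe_le_coe.mp h2]

/-- The valuations at most `N` of the terms of `f` lie in `E`. -/
def ValuesIn (E : Set ℝ) (N : ℝ) (f : KXr K r) : Prop :=
  ∀ (u : Mon n) (v : ℝ), v ≤ N → coeffVal f u = v → v ∈ E

lemma exists_coe_eq_of_le {x : WithTop ℝ} {v : ℝ} (h : x ≤ v) : ∃ a : ℝ, x = a ∧ a ≤ v := by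
  obtain ⟨a, rfl⟩ := WithTop.ne_top_iff_exists.mp (h.trans_lt (WithTop.coe_lt_top v)).ne
  exact ⟨a, rfl, WithTop.coe_le_coe.mp h⟩

lemma exists_val_eq_of_termVal_eq {a : K} {u : Mon n} {c : ℝ} (h : termVal r a u = c) :
    val a = (c + dot r u : ℝ) := by
  have ha : a ≠ 0 := by
    rintro rfl
    rw [termVal_zero] at h
    exact WithTop.top_ne_coe h
  obtain ⟨γ, hγ⟩ := exists_val_eq ha
  rw [termVal, hγ, ← WithTop.coe_add, WithTop.coe_eq_coe] at h
  rw [hγ, ← h, neg_add_cancel_right]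

/-- A term of the difference has valuation at least that of the term of f or of g with the same
exponent u. With u fixed, the two valuations differ by a multiple of ϖ, even if ϖ and the numbers r
· u are incommensurable. -/
lemma ValuesIn.sub {E : Set ℝ} {N ϖ : ℝ} (hϖ : 0 < ϖ)
    (hstep : ∀ (x y : K) (a b : ℝ), val x = a → val y = b → a ≤ b → ∃ k : ℕ, b = a + k * ϖ)
    (hE : ∀ e ∈ E, e + ϖ ≤ N → e + ϖ ∈ E) {f g : KXr K r} (hf : ValuesIn E N f)
    (hg : ValuesIn E N g) : ValuesIn E N (f - g) := by
  intro u v hv huv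
  have hmin := min_coeffVal_le_add f (-g) u
  rw [← sub_eq_add_neg, coeffVal_neg, huv] at hmin
  have key : ∀ p : KXr K r, ValuesIn E N p → coeffVal p u ≤ v → v ∈ E := by
    intro p hp hle
    obtain ⟨a, ha, hav⟩ := exists_coe_eq_of_le hle
    obtain ⟨k, hk⟩ := hstep _ _ _ _ (exists_val_eq_of_termVal_eq ha)
      (exists_val_eq_of_termVal_eq huv) (by linarith)
    obtain rfl : v = a + k * ϖ := by linarith
    exact add_nat_mul_mem hϖ hE (hp u a (hav.trans hv) ha) k hv
  rcases min_le_iff.mp hmin with h | h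
  · exact key f hf h
  · exact key g hg h

end KXr

variable {I : Type*} {T : I → AddSubmonoid (Mon n)} [LinearOrder (Mon n)]

lemma KXr.hasLead_lt {f : KXr K r} {v : ℝ} {m : Mon n} (h : HasLead f v m) :
    lt f = term r (f.coeff m) m ∧ HasLead (lt f) v m := by
  have h1 : lt f = term r (f.coeff m) m := by rw [lt, h.lc_eq, h.lm_eq]
  have h2 : ∀ u, u ≠ m → coeffVal (term r (f.coeff m) m) u = ⊤ := fun u hu => by
    rw [coeffVal, coeff_term_of_ne _ hu, termVal_zero]
  have h3 : coeffVal (term r (f.coeff m) m) m = v := by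
    rw [coeffVal, coeff_term_self]
    exact h.coeffVal_eq
  refine ⟨h1, h1 ▸ ⟨h3, fun u => ?_, fun u hu => ?_⟩⟩
  · by_cases hu : u = m
    · rw [hu, h3]
    · rw [h2 u hu]
      exact le_top
  · rw [h2 u hu.ne']
    exact WithTop.coe_lt_top v

/-- The test fixes the leading monomial of the product, and the division by lc_i(g) fixes its
coefficient there. Equal leading terms have equal valuations. -/
lemma KXr.hasLead_quotTerm_mul (hT : IsConicDecomposition T) (hord : IsGMO T) {i : I}
    {f g : KXr K r} (hg : g ≠ 0) {v : ℝ} {m : Mon n} (hf : HasLead f v m) (h : Reduces T i g f) :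
    HasLead (quotTerm T i g f * g) v m ∧ (quotTerm T i g f * g).coeff m = f.coeff m := by
  have hc0 := lcCone_ne_zero hT hord i hg
  have hc : (quotTerm T i g f * g).coeff m = f.coeff m := by
    rw [quotTerm, coeff_term_mul, hf.lm_eq, hf.lc_eq, sub_sub_cancel,
      ← lcCone_eq hT hord i hg, div_mul_cancel₀ _ hc0]
  refine ⟨?_, hc⟩
  have hne : lc f.initialForm / lcCone T i g.initialForm ≠ 0 :=
    div_ne_zero (hf.lc_eq ▸ hf.coeff_ne_zero) hc0
  obtain ⟨v', hv'⟩ := exists_hasLead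
    (term_mul_ne_zero hne (lm f.initialForm - lmCone T i g.initialForm) hg)
  rw [lm_term_mul hne _ hg, show lm _ = lm f.initialForm from h, hf.lm_eq, ← hf.lm_eq,
    ← quotTerm, hf.lm_eq] at hv'
  have h1 := hv'.coeffVal_eq
  rw [coeffVal, hc, ← coeffVal, hf.coeffVal_eq, WithTop.coe_eq_coe] at h1
  exact h1 ▸ hv'

/-- One step of the division subtracts a series with the same leading term. -/
lemma DivStep.cases_of_hasLead (hT : IsConicDecomposition T) (hord : IsGMO T)
    {G : Finset (KXr K r)} (hG : ∀ g ∈ G, g ≠ 0) {S S' : DivState K r} (h : DivStep T G S S')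
    {v : ℝ} {m : Mon n} (hv : HasLead S.rest v m) : ∃ x : KXr K r, HasLead x v m ∧
      x.coeff m = S.rest.coeff m ∧ S'.rest = S.rest - x ∧
      ((∃ g ∈ G, ∃ c w, x = term r c w * g ∧ S'.quot g = S.quot g + term r c w ∧
        (∀ h ≠ g, S'.quot h = S.quot h) ∧ S'.rem = S.rem) ∨
      x = term r (S.rest.coeff m) m ∧ S'.quot = S.quot ∧ S'.rem = S.rem + x ∧
        ∀ i, ∀ g ∈ G, m ∉ leadSet T i g) := by
  classical
  cases h with
  | reduce f q s i g hf hg hred =>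
    obtain ⟨h1, h2⟩ := hasLead_quotTerm_mul hT hord (hG g hg) hv hred
    refine ⟨_, h1, h2, rfl, Or.inl ⟨g, hg, _, _, rfl, ?_, fun h hh => ?_, rfl⟩⟩
    · exact Function.update_self (β := fun _ => KXr K r) g (q g + quotTerm T i g f) q
    · exact Function.update_of_ne hh (q g + quotTerm T i g f) q
  | move f q s hf hred =>
    obtain ⟨h1, h2⟩ := hasLead_lt hv
    refine ⟨lt f, h2, ?_, rfl, Or.inr ⟨h1, rfl, rfl, fun i g hg hm => hred i g hg ?_⟩⟩
    · rw [h1, coeff_term_self]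
    · exact reduces_of_mem_leadSet hT hord (hG g hg) (hv.lm_eq.symm ▸ hm)
  | halt q s => exact absurd rfl hv.ne_zero

lemma DivStep.eq_of_rest_eq_zero {G : Finset (KXr K r)} {S S' : DivState K r}
    (h : DivStep T G S S') (h0 : S.rest = 0) : S' = S := by
  cases h with
  | reduce f q s i g hf => exact absurd h0 hf
  | move f q s hf => exact absurd h0 hf
  | halt q s => rfl

lemma exists_divStep (G : Finset (KXr K r)) (S : DivState K r) : ∃ S', DivStep T G S S' := by
  obtain ⟨f, q, s⟩ := S
  by_cases hf : f = 0
  · subst hf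
    exact ⟨_, .halt q s⟩
  by_cases h : ∃ i, ∃ g ∈ G, Reduces T i g f
  · obtain ⟨i, g, hg, hr⟩ := h
    exact ⟨_, .reduce f q s i g hf hg hr⟩
  · push Not at h
    exact ⟨_, .move f q s hf h⟩

lemma exists_isDivRun (f : KXr K r) (G : Finset (KXr K r)) : ∃ σ, IsDivRun T f G σ := by
  choose F hF using fun S => exists_divStep (T := T) G S
  exact ⟨fun k => F^[k] ⟨f, fun _ => 0, 0⟩, rfl, fun k => by
    simp only [Function.iterate_succ_apply']
    exact hF _⟩

lemma DivStep.valr_rest_le (hT : IsConicDecomposition T) (hord : IsGMO T)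
    {G : Finset (KXr K r)} (hG : ∀ g ∈ G, g ≠ 0) {S S' : DivState K r} (h : DivStep T G S S') :
    S.rest.valr ≤ S'.rest.valr := by
  by_cases h0 : S.rest = 0
  · rw [h.eq_of_rest_eq_zero h0]
  obtain ⟨v, hv⟩ := exists_hasLead h0
  obtain ⟨x, hx, hc, hS, -⟩ := h.cases_of_hasLead hT hord hG hv
  rw [hv.valr_eq, hS]
  exact le_valr_iff.mpr fun u => (hv.sub_mem_below hx hc.symm u).1

lemma IsDivRun.valr_rest_mono (hT : IsConicDecomposition T) (hord : IsGMO T)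
    {G : Finset (KXr K r)} (hG : ∀ g ∈ G, g ≠ 0) {f : KXr K r} {σ : ℕ → DivState K r}
    (h : IsDivRun T f G σ) : Monotone fun k => (σ k).rest.valr :=
  monotone_nat_of_le_succ fun k => (h.2 k).valr_rest_le hT hord hG

/-- What remains to be divided tends to zero. -/
lemma IsDivRun.tendsTo_rest [Finite I] (hT : IsConicDecomposition T) (hord : IsGMO T)
    {G : Finset (KXr K r)} (hG : ∀ g ∈ G, g ≠ 0) {f : KXr K r} {σ : ℕ → DivState K r}
    (h : IsDivRun T f G σ) : TendsTo (fun k => (σ k).rest) 0 := by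
  have := hT.wellFoundedLT hord
  have hmono := h.valr_rest_mono hT hord hG
  rw [tendsTo_iff]
  intro N
  by_contra hcon
  have hle : ∀ k, (σ k).rest.valr ≤ N := by
    intro k
    by_contra! hlt
    refine hcon (eventually_atTop.mpr ⟨k, fun l hl => ?_⟩)
    rw [sub_zero]
    exact lt_of_lt_of_le hlt (hmono hl)
  have hne : ∀ k, (σ k).rest ≠ 0 := fun k h0 => by
    have := hle k
    rw [h0, valr_zero] at this
    exact absurd this (not_le.mpr (WithTop.coe_lt_top N))
  choose v hv using fun k => exists_hasLead (hne k)
  have hvN : ∀ k, v k ≤ N := fun k => WithTop.coe_le_coe.mp ((hv k).valr_eq ▸ hle k)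
  have hv0 : ∀ k, v 0 ≤ v k := fun k => by
    have := hmono (Nat.zero_le k)
    simp only [(hv _).valr_eq] at this
    exact WithTop.coe_le_coe.mp this
  obtain ⟨ϖ, hϖ, hstep⟩ := exists_val_step K
  -- The increments over val_r(g) of the terms of the divisors. Those above N - v 0 are irrelevant:
  -- as v k ≥ v 0, the terms they produce have valuation greater than N.
  obtain ⟨A, hA, hA0, hAG⟩ := exists_finite_forall_of_mono G.finite_toSet
    (P := fun g A => ∀ a, a ≤ N - v 0 → (∃ u, coeffVal g u = g.valr + (a : WithTop ℝ)) → a ∈ A)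
    (fun g A B hAB h a ha hu => hAB (h a ha hu)) (fun g hg => by
      obtain ⟨w, hw⟩ := exists_valr_eq (hG g hg)
      refine ⟨{a | a ≤ N - v 0 ∧ ∃ u, coeffVal g u = g.valr + (a : WithTop ℝ)}, ?_, ?_,
        fun a ha hu => ⟨ha, hu⟩⟩
      · refine ((finite_coeffVal_le g (N - v 0 + w)).image fun a => a - w).subset ?_
        rintro a ⟨ha, u, hu⟩
        refine ⟨w + a, ⟨by linarith, u, ?_⟩, by simp⟩
        rw [hu, hw, WithTop.coe_add]
      · rintro a ⟨-, u, hu⟩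
        have := g.valr_le u
        rw [← coeffVal, hu, hw, ← WithTop.coe_add, WithTop.coe_le_coe] at this
        linarith)
  obtain ⟨E, hE, hEN, hVE, hEA⟩ := exists_finite_add_closed (finite_coeffVal_le f N)
    (hA.insert ϖ) (by
      rintro a (rfl | ha)
      exacts [hϖ.le, hA0 a ha]) N
  have hEϖ : ∀ e ∈ E, e + ϖ ≤ N → e + ϖ ∈ E := fun e he => hEA e he ϖ (Set.mem_insert _ _)
  -- The terms introduced at step k have valuation v k plus an increment of g. As v k is itself in
  -- E, the sum is in E when it is at most N; when a term moves to the remainder, no other valuation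
  -- appears.
  have hvals : ∀ k, ValuesIn E N (σ k).rest := by
    intro k
    induction k with
    | zero =>
      intro u a ha hua
      rw [h.1] at hua
      exact hVE a ⟨ha, u, hua⟩ ha
    | succ k ih =>
      have hvE : v k ∈ E := ih _ _ (hvN k) (hv k).coeffVal_eq
      obtain ⟨x, hx, -, hS, hcase⟩ := (h.2 k).cases_of_hasLead hT hord hG (hv k)
      rw [hS]
      refine ih.sub hϖ hstep hEϖ ?_
      intro u a ha hua
      rcases hcase with ⟨g, hg, c, w, rfl, -⟩ | ⟨rfl, -⟩
      · have h1 := hx.valr_eq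
        obtain ⟨γ, hγ⟩ := exists_valr_eq (hG g hg)
        obtain ⟨δ, hδ⟩ := exists_termVal_eq (r := r) hx.term_mul_ne.1 w
        rw [valr_term_mul, hδ, hγ, ← WithTop.coe_add, WithTop.coe_eq_coe] at h1
        rw [coeffVal_term_mul, hδ] at hua
        obtain ⟨b, hb, -⟩ := exists_coe_eq_of_le
          (x := coeffVal g (u - w)) (v := a - δ) (by
            cases hcv : coeffVal g (u - w) with
            | top => rw [hcv] at hua; simp at hua
            | coe b =>
              rw [hcv, ← WithTop.coe_add, WithTop.coe_eq_coe] at hua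
              exact WithTop.coe_le_coe.mpr (by linarith))
        rw [hb, ← WithTop.coe_add, WithTop.coe_eq_coe] at hua
        have h2 : b - γ ∈ A := hAG g hg _ (by linarith [hv0 k]) ⟨u - w, by
          rw [hb, hγ, ← WithTop.coe_add, add_sub_cancel]⟩
        have h3 := hEA _ hvE _ (Set.mem_insert_of_mem ϖ h2) (by linarith)
        rwa [show v k + (b - γ) = a by linarith] at h3
      · by_cases hu : u = lm (σ k).rest.initialForm
        · rw [hu, hx.coeffVal_eq, WithTop.coe_eq_coe] at hua
          exact hua ▸ hvE
        · rw [coeffVal, coeff_term_of_ne _ hu, termVal_zero] at hua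
          exact absurd hua WithTop.top_ne_coe
  have hvE : ∀ k, v k ∈ E := fun k => hvals k _ _ (hvN k) (hv k).coeffVal_eq
  -- The leading terms cancel, so the levels strictly decrease, with valuations in the finite set E:
  -- this is impossible.
  refine (wellFounded_iff_isEmpty_descending_chain.mp
    (wellFounded_level (α := Mon n) hE)).false
    ⟨fun k => (⟨v k, hvE k⟩, lm (σ k).rest.initialForm), fun k => ?_⟩
  obtain ⟨x, hx, hc, hS, -⟩ := (h.2 k).cases_of_hasLead hT hord hG (hv k)
  have hb := (hv k).sub_mem_below hx hc.symm
  rw [← hS] at hb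
  exact (hv (k + 1)).mem_below_iff.mp hb

/-- Every division converges. -/
lemma IsDivRun.exists_outputs [Finite I] (hT : IsConicDecomposition T) (hord : IsGMO T)
    {G : Finset (KXr K r)} (hG : ∀ g ∈ G, g ≠ 0) {f : KXr K r} {σ : ℕ → DivState K r}
    (h : IsDivRun T f G σ) : ∃ q s, DivRunOutputs σ q s := by
  have hrest := h.tendsTo_rest hT hord hG
  have hrest' := tendsTo_iff.mp hrest
  simp only [sub_zero] at hrest'
  have hrem : ∃ s, TendsTo (fun k => (σ k).rem) s := by
    refine exists_tendsTo fun N => (hrest' N).mono fun k hk => ?_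
    by_cases h0 : (σ k).rest = 0
    · rw [(h.2 k).eq_of_rest_eq_zero h0, sub_self]
      exact zero_mem _
    obtain ⟨v, hv⟩ := exists_hasLead h0
    obtain ⟨x, hx, -, -, ⟨g, -, c, w, -, -, -, h1⟩ | ⟨-, -, h1, -⟩⟩ :=
      (h.2 k).cases_of_hasLead hT hord hG hv
    · rw [h1, sub_self]
      exact zero_mem _
    · rw [h1, add_sub_cancel_left, mem_valGt, hx.valr_eq, ← hv.valr_eq]
      exact hk
  have hquot : ∀ g, ∃ q, TendsTo (fun k => (σ k).quot g) q := by
    intro g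
    -- Zero is not a divisor, so its quotient never changes. It is treated apart because the
    -- estimate below uses a finite valuation of g.
    by_cases hg : g = 0
    · refine exists_tendsTo fun N => .of_forall fun k => ?_
      by_cases h0 : (σ k).rest = 0
      · rw [(h.2 k).eq_of_rest_eq_zero h0, sub_self]
        exact zero_mem _
      obtain ⟨v, hv⟩ := exists_hasLead h0
      obtain ⟨x, hx, -, -, ⟨g', hg', c, w, -, -, h1, -⟩ | ⟨-, h1, -⟩⟩ :=
        (h.2 k).cases_of_hasLead hT hord hG hv
      · rw [h1 g (fun he => hG g' hg' (he ▸ hg)), sub_self]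
        exact zero_mem _
      · rw [h1, sub_self]
        exact zero_mem _
    obtain ⟨γ, hγ⟩ := exists_valr_eq hg
    -- The term added to the quotient of g has the valuation of the current rest minus that of g,
    -- whence the shift by γ.
    refine exists_tendsTo fun N => (hrest' (N + γ)).mono fun k hk => ?_
    by_cases h0 : (σ k).rest = 0
    · rw [(h.2 k).eq_of_rest_eq_zero h0, sub_self]
      exact zero_mem _
    obtain ⟨v, hv⟩ := exists_hasLead h0
    obtain ⟨x, hx, -, -, ⟨g', hg', c, w, rfl, h2, h1, -⟩ | ⟨-, h1, -⟩⟩ :=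
      (h.2 k).cases_of_hasLead hT hord hG hv
    · by_cases he : g = g'
      · subst he
        have h3 := hx.valr_eq
        rw [mem_valGt, hv.valr_eq, WithTop.coe_lt_coe] at hk
        obtain ⟨δ, hδ⟩ := exists_termVal_eq (r := r) hx.term_mul_ne.1 w
        rw [valr_term_mul, hδ, hγ, ← WithTop.coe_add, WithTop.coe_eq_coe] at h3
        rw [h2, add_sub_cancel_left, mem_valGt, valr_term, hδ, WithTop.coe_lt_coe]
        linarith
      · rw [h1 g he, sub_self]
        exact zero_mem _
    · rw [h1, sub_self]
      exact zero_mem _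
  obtain ⟨s, hs⟩ := hrem
  choose q hq using hquot
  exact ⟨q, s, hrest, hq, hs⟩

lemma exists_isRemainder [Finite I] (hT : IsConicDecomposition T) (hord : IsGMO T)
    {G : Finset (KXr K r)} (hG : ∀ g ∈ G, g ≠ 0) (f : KXr K r) : ∃ s, IsRemainder T f G s := by
  obtain ⟨σ, hσ⟩ := exists_isDivRun (T := T) f G
  obtain ⟨q, s, h⟩ := hσ.exists_outputs hT hord hG
  exact ⟨s, σ, q, hσ, h⟩

lemma IsDivRun.rest_add_sum_add_rem (hT : IsConicDecomposition T) (hord : IsGMO T)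
    {G : Finset (KXr K r)} (hG : ∀ g ∈ G, g ≠ 0) {f : KXr K r} {σ : ℕ → DivState K r}
    (h : IsDivRun T f G σ) (k : ℕ) :
    (σ k).rest + ∑ g ∈ G, (σ k).quot g * g + (σ k).rem = f := by
  classical
  induction k with
  | zero => simp [h.1]
  | succ k ih =>
    by_cases h0 : (σ k).rest = 0
    · rw [(h.2 k).eq_of_rest_eq_zero h0, ih]
    obtain ⟨v, hv⟩ := exists_hasLead h0
    obtain ⟨x, -, -, hS, ⟨g, hg, c, w, rfl, h2, h1, h3⟩ | ⟨-, h1, h3, -⟩⟩ :=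
      (h.2 k).cases_of_hasLead hT hord hG hv
    · rw [← Finset.add_sum_erase _ _ hg] at ih ⊢
      rw [Finset.sum_congr rfl fun g' hg' => by rw [h1 g' (Finset.ne_of_mem_erase hg')], hS, h2, h3,
        ← ih]
      ring
    · rw [hS, h1, h3, ← ih]
      ring

/-- A remainder differs from the dividend by an element of the ideal. -/
lemma IsRemainder.sub_mem (hT : IsConicDecomposition T) (hord : IsGMO T)
    {G : Finset (KXr K r)} (hG : ∀ g ∈ G, g ≠ 0) {f s : KXr K r} (h : IsRemainder T f G s)
    {J : Ideal (KXr K r)} (hJ : ∀ g ∈ G, g ∈ J) : f - s ∈ J := by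
  obtain ⟨σ, q, hσ, h1, h2, h3⟩ := h
  -- The identity f = rest + ∑ q_g g + rem, valid at each step, passes to the limit because
  -- multiplication by g is continuous.
  have hlim := (h1.add (tendsTo_sum G fun g _ => (h2 g).mul_const g)).add h3
  simp only [hσ.rest_add_sum_add_rem hT hord hG] at hlim
  rw [(tendsTo_const f).unique hlim, zero_add, add_sub_cancel_right]
  exact sum_mem fun g hg => J.mul_mem_left _ (hJ g hg)

/-- No exponent of a remainder lies in a leading set. -/
lemma IsRemainder.notMem_leadSet (hT : IsConicDecomposition T) (hord : IsGMO T)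
    {G : Finset (KXr K r)} (hG : ∀ g ∈ G, g ≠ 0) {f s : KXr K r} (h : IsRemainder T f G s)
    {u : Mon n} (hu : s.coeff u ≠ 0) (i : I) {g : KXr K r} (hg : g ∈ G) : u ∉ leadSet T i g := by
  obtain ⟨σ, q, hσ, -, -, h3⟩ := h
  have hrem : ∀ k u, (σ k).rem.coeff u ≠ 0 → u ∉ leadSet T i g := by
    intro k
    induction k with
    | zero =>
      intro u hu
      rw [hσ.1] at hu
      exact absurd (coeff_zero u) hu
    | succ k ih =>
      intro u hu
      by_cases h0 : (σ k).rest = 0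
      · rw [(hσ.2 k).eq_of_rest_eq_zero h0] at hu
        exact ih u hu
      obtain ⟨v, hv⟩ := exists_hasLead h0
      obtain ⟨x, -, -, -, ⟨_, -, c, w, -, -, -, h1⟩ | ⟨hx, -, h1, h2⟩⟩ :=
        (hσ.2 k).cases_of_hasLead hT hord hG hv
      · rw [h1] at hu
        exact ih u hu
      · by_cases hum : u = lm (σ k).rest.initialForm
        · exact hum ▸ h2 i g hg
        · rw [h1, coeff_add, hx, coeff_term_of_ne _ hum, add_zero] at hu
          exact ih u hu
  -- At a late stage the error has valuation greater than c, so it cannot create the term of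
  -- exponent u: this exponent already occurs in the partial remainder.
  obtain ⟨c, hc⟩ := exists_termVal_eq (r := r) hu u
  obtain ⟨k, hk⟩ := (tendsTo_iff.mp h3 c).exists
  refine hrem k u fun h0 => ?_
  have := lt_valr_iff.mp hk u
  rw [coeffVal, coeff_sub, h0, zero_sub, termVal_neg, hc] at this
  exact this.false

/-- The terms subtracted in a division are bounded by the dividend. -/
lemma IsRemainder.sub_mem_closure (hT : IsConicDecomposition T) (hord : IsGMO T)
    {G : Finset (KXr K r)} (hG : ∀ g ∈ G, g ≠ 0) {f s : KXr K r} (h : IsRemainder T f G s)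
    {β : ℝ} {m : Mon n} (hf : f ∈ below r β m) : s ∈ below r β m ∧ ∀ N, f - s ∈
      AddSubgroup.closure {y | ∃ g ∈ G, ∃ c w, y = term r c w * g ∧ y ∈ below r β m} ⊔
        valGt r N := by
  obtain ⟨σ, q, hσ, h1, -, h3⟩ := h
  -- Each subtracted series has the level of the current rest, so rest, remainder and subtracted
  -- multiples all stay in the subgroup that contains f.
  have key : ∀ k, (σ k).rest ∈ below r β m ∧ (σ k).rem ∈ below r β m ∧
      f - (σ k).rest - (σ k).rem ∈
        AddSubgroup.closure {y | ∃ g ∈ G, ∃ c w, y = term r c w * g ∧ y ∈ below r β m} := by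
    intro k
    induction k with
    | zero =>
      rw [hσ.1]
      refine ⟨hf, zero_mem _, ?_⟩
      simp [zero_mem]
    | succ k ih =>
      obtain ⟨ih1, ih2, ih3⟩ := ih
      by_cases h0 : (σ k).rest = 0
      · rw [(hσ.2 k).eq_of_rest_eq_zero h0]
        exact ⟨ih1, ih2, ih3⟩
      obtain ⟨v, hv⟩ := exists_hasLead h0
      obtain ⟨x, hx, -, hS, hcase⟩ := (hσ.2 k).cases_of_hasLead hT hord hG hv
      have hxb := hv.mem_below_of_le hx ih1
      refine ⟨hS ▸ AddSubgroup.sub_mem _ ih1 hxb, ?_⟩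
      rcases hcase with ⟨g, hg, c, w, hxg, -, -, h4⟩ | ⟨-, -, h4, -⟩
      · refine ⟨h4 ▸ ih2, ?_⟩
        have := add_mem ih3 (AddSubgroup.subset_closure
          (show x ∈ {y | ∃ g ∈ G, ∃ c w, y = term r c w * g ∧ y ∈ below r β m} from
            ⟨g, hg, c, w, hxg, hxb⟩))
        rw [hS, h4]
        convert this using 1
        abel
      · refine ⟨h4 ▸ add_mem ih2 hxb, ?_⟩
        rw [hS, h4]
        convert ih3 using 1
        abel
  have hlim := fun N => ((tendsTo_iff.mp h1 N).and (tendsTo_iff.mp h3 N)).exists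
  constructor
  · obtain ⟨k, -, hk⟩ := hlim β
    have := AddSubgroup.sub_mem _ (key k).2.1 (valGt_le_below le_rfl m hk)
    rwa [sub_sub_cancel] at this
  · intro N
    obtain ⟨k, hk, hk'⟩ := hlim N
    rw [AddSubgroup.mem_sup]
    refine ⟨_, (key k).2.2, (σ k).rest + ((σ k).rem - s), add_mem ?_ hk', by abel⟩
    rwa [sub_zero] at hk

end Division

end LaurentGB

namespace LaurentGB

open Filter Topology KXr
open scoped Pointwise

/-! ### Standard representations of S-pairs -/

section Closure

variable {R : Type*} [Ring R]

lemma closure_sup_mono {S S' : Set R} (h : ∀ x ∈ S, x ∈ S') {V : AddSubgroup R} {x : R}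
    (hx : x ∈ AddSubgroup.closure S ⊔ V) : x ∈ AddSubgroup.closure S' ⊔ V :=
  (sup_le_sup_right (AddSubgroup.closure_mono h) V :) hx

lemma mul_mem_of_mem_closure_sup {S : Set R} {V P : AddSubgroup R}
    {x t : R} (hx : x ∈ AddSubgroup.closure S ⊔ V) (hS : ∀ y ∈ S, t * y ∈ P)
    (hV : ∀ y ∈ V, t * y ∈ P) : t * x ∈ P := by
  have : AddSubgroup.closure S ⊔ V ≤ P.comap (AddMonoidHom.mulLeft t) :=
    sup_le ((AddSubgroup.closure_le _).mpr hS) hV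
  exact this hx

end Closure

section Standard

variable {K : Type*} [Field K] [CompleteDVField K] {n : ℕ} {r : Fin n → ℚ} {I : Type*}
  (T : I → AddSubmonoid (Mon n)) [LinearOrder (Mon n)]

/-- The common valuation of the two series whose leading terms cancel in `S(i,f,g,v)`. -/
noncomputable def sLevel (i : I) (f g : KXr K r) (v : Mon n) : ℝ :=
  (val (lcCone T i f.initialForm)).untopD 0 + (val (lcCone T i g.initialForm)).untopD 0 - dot r v

/-- Up to terms of arbitrarily large valuation, `S(i,f,g,v)` is a sum of multiples of elements
of `H` smaller than the terms that cancel in it. -/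
def IsStandard (H : Finset (KXr K r)) (i : I) (f g : KXr K r) (v : Mon n) : Prop :=
  ∀ N, sPair T i f g v ∈ AddSubgroup.closure {y | ∃ h ∈ H, ∃ c w, y = term r c w * h ∧
    y ∈ below r (sLevel T i f g v) v} ⊔ valGt r N

/-- Up to terms whose valuation increases by more than `M`, `S(i,f,g,v)` is a sum of multiples of
elements of `H` smaller than the terms that cancel in it, with increases of the valuation in `A`. -/
def IsStandardIn (A : Set ℝ) (M : ℝ) (H : Finset (KXr K r)) (i : I) (f g : KXr K r)
    (v : Mon n) : Prop :=
  sPair T i f g v ∈ AddSubgroup.closure {y | ∃ h ∈ H, ∃ c w, y = term r c w * h ∧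
    y ∈ below r (sLevel T i f g v) v ∧ ∃ a ∈ A, y.valr = (sLevel T i f g v + a : ℝ)} ⊔
      valGt r (sLevel T i f g v + M)

/-- All S-pairs of `f` and `g` in the cone `i` reduce to zero. -/
def ConeDone (H : Finset (KXr K r)) (i : I) (f g : KXr K r) : Prop :=
  ∃ U, IsGeneratingSet T i f g U ∧ ∀ v ∈ U, IsStandard T H i f g v

variable {T}

lemma sLevel_comm (i : I) (f g : KXr K r) (v : Mon n) :
    sLevel T i f g v = sLevel T i g f v := by
  rw [sLevel, sLevel, add_comm (WithTop.untopD 0 (val (lcCone T i f.initialForm)))]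

lemma sLevel_add (i : I) (f g : KXr K r) (s v : Mon n) :
    sLevel T i f g (s + v) = -dot r s + sLevel T i f g v := by
  rw [sLevel, sLevel, dot_add]
  ring

lemma sPair_comm (i : I) (f g : KXr K r) (v : Mon n) :
    sPair T i f g v = -sPair T i g f v := by
  rw [sPair, sPair, neg_sub]

lemma sPair_self (i : I) (f : KXr K r) (v : Mon n) : sPair T i f f v = 0 := sub_self _

lemma sPair_add (i : I) (f g : KXr K r) (s v : Mon n) :
    sPair T i f g (s + v) = term r 1 s * sPair T i f g v := by
  rw [sPair, sPair, mul_sub, ← mul_assoc, ← mul_assoc, term_mul_term, term_mul_term, one_mul,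
    one_mul, add_sub_assoc, add_sub_assoc]

lemma hasLead_term_sub_lmCone (hT : IsConicDecomposition T) (hord : IsGMO T) {i : I}
    {f : KXr K r} (hf : f ≠ 0) {v : Mon n} (hv : v ∈ leadSet T i f) {c : K} (hc : c ≠ 0) :
    HasLead (term r c (v - lmCone T i f.initialForm) * f)
      ((val c).untopD 0 + (val (lcCone T i f.initialForm)).untopD 0 - dot r v) v ∧
    (term r c (v - lmCone T i f.initialForm) * f).coeff v = c * lcCone T i f.initialForm := by
  have h1 : (term r c (v - lmCone T i f.initialForm) * f).coeff v
      = c * lcCone T i f.initialForm := by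
    rw [coeff_term_mul, sub_sub_cancel, lcCone_eq hT hord i hf]
  obtain ⟨b, hb⟩ := exists_hasLead (term_mul_ne_zero hc (v - lmCone T i f.initialForm) hf)
  rw [lm_term_mul hc _ hf, lm_shift_sub_lmCone hT hord hf hv] at hb
  refine ⟨?_, h1⟩
  have h2 := hb.coeffVal_eq
  obtain ⟨γ, hγ⟩ := exists_val_eq hc
  obtain ⟨δ, hδ⟩ := exists_val_eq (lcCone_ne_zero hT hord i hf)
  rw [coeffVal, h1, termVal, val_mul, hγ, hδ, ← WithTop.coe_add, ← WithTop.coe_add,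
    WithTop.coe_eq_coe] at h2
  rw [hγ, hδ, WithTop.untopD_coe, WithTop.untopD_coe, show γ + δ - dot r v = b from h2]
  exact hb

/-- The two products have the same leading term, with monomial v and coefficient lc_i(f) lc_i(g),
and it cancels. -/
lemma sPair_mem_below (hT : IsConicDecomposition T) (hord : IsGMO T) {i : I} {f g : KXr K r}
    (hf : f ≠ 0) (hg : g ≠ 0) {v : Mon n} (hv : v ∈ leadSet T i f ∩ leadSet T i g) :
    sPair T i f g v ∈ below r (sLevel T i f g v) v := by
  obtain ⟨h1, h2⟩ := hasLead_term_sub_lmCone hT hord hf hv.1 (lcCone_ne_zero hT hord i hg)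
  obtain ⟨h3, h4⟩ := hasLead_term_sub_lmCone hT hord hg hv.2 (lcCone_ne_zero hT hord i hf)
  rw [add_comm (WithTop.untopD 0 (val (lcCone T i g.initialForm)))] at h1
  exact h1.sub_mem_below h3 (by rw [h2, h4, mul_comm])

lemma IsStandard.mono {H H' : Finset (KXr K r)} (hH : H ⊆ H') {i : I} {f g : KXr K r} {v : Mon n}
    (h : IsStandard T H i f g v) : IsStandard T H' i f g v := fun N =>
  closure_sup_mono (by rintro _ ⟨p, hp, hy⟩; exact ⟨p, hH hp, hy⟩) (h N)

lemma ConeDone.mono {H H' : Finset (KXr K r)} (hH : H ⊆ H') {i : I} {f g : KXr K r}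
    (h : ConeDone T H i f g) : ConeDone T H' i f g := by
  obtain ⟨U, hU, h⟩ := h
  exact ⟨U, hU, fun v hv => (h v hv).mono hH⟩

lemma IsRemainder.isStandard_zero (hT : IsConicDecomposition T) (hord : IsGMO T)
    {H : Finset (KXr K r)} (hH : ∀ h ∈ H, h ≠ 0) {i : I} {f g : KXr K r}
    (hf : f ≠ 0) (hg : g ≠ 0) {v : Mon n} (hv : v ∈ leadSet T i f ∩ leadSet T i g)
    (h : IsRemainder T (sPair T i f g v) H 0) : IsStandard T H i f g v := by
  have := (h.sub_mem_closure hT hord hH (sPair_mem_below hT hord hf hg hv)).2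
  rwa [sub_zero] at this

lemma IsRemainder.isStandard_insert [DecidableEq (KXr K r)] (hT : IsConicDecomposition T)
    (hord : IsGMO T) {H : Finset (KXr K r)} (hH : ∀ h ∈ H, h ≠ 0) {i : I} {f g : KXr K r}
    (hf : f ≠ 0) (hg : g ≠ 0) {v : Mon n} (hv : v ∈ leadSet T i f ∩ leadSet T i g)
    {s : KXr K r} (h : IsRemainder T (sPair T i f g v) H s) :
    IsStandard T (insert s H) i f g v := by
  obtain ⟨hs, h1⟩ := h.sub_mem_closure hT hord hH (sPair_mem_below hT hord hf hg hv)
  intro N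
  rw [← sub_add_cancel (sPair T i f g v) s]
  refine add_mem ?_ ?_
  · exact closure_sup_mono (by
      rintro _ ⟨p, hp, hy⟩
      exact ⟨p, Finset.mem_insert_of_mem hp, hy⟩) (h1 N)
  -- The remainder is a summand itself, as the multiple of the new element s by the term 1.
  · refine AddSubgroup.mem_sup_left (AddSubgroup.subset_closure
      ⟨s, Finset.mem_insert_self _ _, 1, 0, ?_, hs⟩)
    rw [← one_def, one_mul]

lemma KXr.le_valr_of_mem_below {f : KXr K r} {v : ℝ} {m : Mon n} (h : f ∈ below r v m) :
    (v : WithTop ℝ) ≤ f.valr := le_valr_iff.mpr fun u => (h u).1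

/-- Once the truncation is fixed, only finitely many summands occur. Their increments form A,
nonnegative because each summand is below the level of the cancelling terms. -/
lemma IsStandard.exists_isStandardIn {H : Finset (KXr K r)} {i : I} {f g : KXr K r} {v : Mon n}
    (h : IsStandard T H i f g v) (M : ℝ) : ∃ A : Set ℝ, A.Finite ∧ (∀ a ∈ A, 0 ≤ a) ∧
      IsStandardIn T A M H i f g v := by
  obtain ⟨y, hy, e, he, hye⟩ := AddSubgroup.mem_sup.mp (h (sLevel T i f g v + M))
  obtain ⟨Y, hYS, hY, hyY⟩ := exists_finite_subset_mem_closure hy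
  refine ⟨{a | ∃ y ∈ Y, y.valr = (sLevel T i f g v + a : ℝ)}, ?_, ?_, ?_⟩
  · refine (hY.image fun y => y.valr.untopD 0 - sLevel T i f g v).subset ?_
    rintro a ⟨y, hy, ha⟩
    exact ⟨y, hy, by simp only [ha, WithTop.untopD_coe, add_sub_cancel_left]⟩
  · rintro a ⟨y, hy, ha⟩
    obtain ⟨p, hp, c, w, -, hb⟩ := hYS hy
    have := WithTop.coe_le_coe.mp ((le_valr_of_mem_below hb).trans_eq ha)
    linarith
  · rw [IsStandardIn, ← hye]
    refine add_mem (AddSubgroup.mem_sup_left ?_) (AddSubgroup.mem_sup_right he)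
    refine (AddSubgroup.closure_le _).mpr (fun z hz => ?_) hyY
    -- A zero summand has no real valuation, hence no increment, and is dropped.
    by_cases h0 : z = 0
    · rw [h0]
      exact zero_mem _
    obtain ⟨p, hp, c, w, hz', hb⟩ := hYS hz
    obtain ⟨b, hb'⟩ := exists_valr_eq h0
    have hb'' : z.valr = (sLevel T i f g v + (b - sLevel T i f g v) : ℝ) := by
      rw [hb', add_sub_cancel]
    exact AddSubgroup.subset_closure ⟨p, hp, c, w, hz', hb, _, ⟨z, hz, hb''⟩, hb''⟩

lemma IsStandardIn.mono {A B : Set ℝ} (hAB : A ⊆ B) {M : ℝ} {H : Finset (KXr K r)} {i : I}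
    {f g : KXr K r} {v : Mon n} (h : IsStandardIn T A M H i f g v) :
    IsStandardIn T B M H i f g v :=
  closure_sup_mono (by
    rintro _ ⟨p, hp, c, w, h1, h2, a, ha, h3⟩
    exact ⟨p, hp, c, w, h1, h2, a, hAB ha, h3⟩) h

lemma IsStandardIn.symm {A : Set ℝ} {M : ℝ} {H : Finset (KXr K r)} {i : I} {f g : KXr K r}
    {v : Mon n} (h : IsStandardIn T A M H i f g v) : IsStandardIn T A M H i g f v := by
  rw [IsStandardIn, sPair_comm, sLevel_comm]
  exact neg_mem h

/-- Translation by s multiplies the S-pair and its representation by one monomial, and moves all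
valuations by - r · s, so the increments relative to `sLevel` do not change. The bound by the level
survives because s and v lie in the same cone. -/
lemma IsStandardIn.add (hord : IsGMO T) {A : Set ℝ} {M : ℝ} {H : Finset (KXr K r)} {i : I}
    {f g : KXr K r} {v s : Mon n} (hv : v ∈ T i) (hs : s ∈ T i)
    (h : IsStandardIn T A M H i f g v) : IsStandardIn T A M H i f g (s + v) := by
  rw [IsStandardIn, sPair_add, sLevel_add]
  refine mul_mem_of_mem_closure_sup h ?_ fun e he => ?_
  · rintro y ⟨p, hp, c, w, rfl, hb, a, ha, hy⟩
    refine AddSubgroup.mem_sup_left (AddSubgroup.subset_closure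
      ⟨p, hp, 1 * c, s + w, ?_, shift_mem_below hord hb hv hs, a, ha, ?_⟩)
    · rw [← mul_assoc, term_mul_term]
    · rw [valr_term_mul, hy, termVal_one, ← WithTop.coe_add, add_assoc]
  · have := term_mul_mem_valGt (termVal_one s) he
    rw [← add_assoc] at this
    exact AddSubgroup.mem_sup_right this

/-- Every m in the intersection is a translate of one of finitely many generators, and translation
preserves increments, so one finite A serves infinitely many S-pairs. -/
lemma ConeDone.exists_isStandardIn (hT : IsConicDecomposition T) (hord : IsGMO T)
    {H : Finset (KXr K r)} {i : I} {f g : KXr K r} (hf : f ≠ 0) (h : ConeDone T H i f g) (M : ℝ) :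
    ∃ A : Set ℝ, A.Finite ∧ (∀ a ∈ A, 0 ≤ a) ∧
      ∀ m ∈ leadSet T i f ∩ leadSet T i g, IsStandardIn T A M H i f g m := by
  obtain ⟨U, hU, h⟩ := h
  obtain ⟨A, hA, hA0, hAU⟩ := exists_finite_forall_of_mono U.finite_toSet
    (P := fun v A => IsStandardIn T A M H i f g v) (fun _ _ _ hAB h => h.mono hAB)
    fun v hv => (h v hv).exists_isStandardIn M
  refine ⟨A, hA, hA0, fun m hm => ?_⟩
  rw [← hU] at hm
  obtain ⟨s, hs, v, hv, rfl⟩ := hm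
  exact (hAU v hv).add hord ((mem_leadSet_iff hT hord hf).mp (hU.subset hv).1).1 hs

/-- A finite set of increases of the valuation suffices for all S-pairs of elements of `H`. -/
lemma exists_forall_isStandardIn [Finite I] (hT : IsConicDecomposition T) (hord : IsGMO T)
    {H : Finset (KXr K r)} (hH : ∀ h ∈ H, h ≠ 0)
    (hdone : ∀ f ∈ H, ∀ g ∈ H, f ≠ g → (∀ i, ConeDone T H i f g) ∨ ∀ i, ConeDone T H i g f)
    (M : ℝ) : ∃ A : Set ℝ, A.Finite ∧ (∀ a ∈ A, 0 ≤ a) ∧ ∀ f ∈ H, ∀ g ∈ H, ∀ i,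
      ∀ m ∈ leadSet T i f ∩ leadSet T i g, IsStandardIn T A M H i f g m := by
  obtain ⟨A, hA, hA0, hAH⟩ := exists_finite_forall_of_mono
    ((H.finite_toSet.prod H.finite_toSet).prod (Set.finite_univ (α := I)))
    (P := fun p A => ∀ m ∈ leadSet T p.2 p.1.1 ∩ leadSet T p.2 p.1.2,
      IsStandardIn T A M H p.2 p.1.1 p.1.2 m) (fun _ _ _ hAB h m hm => (h m hm).mono hAB) (by
      rintro ⟨⟨f, g⟩, i⟩ ⟨⟨hf, hg⟩, -⟩
      by_cases hfg : f = g
      · refine ⟨∅, Set.finite_empty, by simp, fun m _ => ?_⟩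
        rw [IsStandardIn, hfg, sPair_self]
        exact zero_mem _
      rcases hdone f hf g hg hfg with h | h
      · exact (h i).exists_isStandardIn hT hord (hH f hf) M
      · obtain ⟨A, hA, hA0, h⟩ := (h i).exists_isStandardIn hT hord (hH g hg) M
        exact ⟨A, hA, hA0, fun m hm => (h m hm.symm).symm⟩)
  exact ⟨A, hA, hA0, fun f hf g hg i m hm => hAH ⟨⟨f, g⟩, i⟩ ⟨⟨hf, hg⟩, trivial⟩ m hm⟩

end Standard

/-! ### Buchberger's criterion -/

section Criterion

variable {K : Type*} [Field K] [CompleteDVField K] {n : ℕ} {r : Fin n → ℚ}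

lemma KXr.exists_sub_sum_term_mem_valGt (a : KXr K r) (N : ℝ) :
    ∃ F : Finset (Mon n), a - ∑ u ∈ F, term r (a.coeff u) u ∈ valGt r N := by
  classical
  have hfin : {u | ¬ ((N + 1 : ℝ) : WithTop ℝ) ≤ termVal r (a.coeff u) u}.Finite := a.conv (N + 1)
  refine ⟨hfin.toFinset, lt_valr_iff.mpr fun u => ?_⟩
  have hcoeff : ∀ F : Finset (Mon n), (∑ w ∈ F, term r (a.coeff w) w).coeff u =
      if u ∈ F then a.coeff u else 0 := by
    intro F
    induction F using Finset.induction_on with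
    | empty => simp [coeff_zero]
    | insert w F hw ih =>
      rw [Finset.sum_insert hw, coeff_add, ih]
      by_cases huw : u = w
      · subst huw
        simp [hw, coeff_term_self]
      · simp [huw, coeff_term_of_ne _ huw]
  rw [coeffVal, coeff_sub, hcoeff]
  by_cases hu : u ∈ hfin.toFinset
  · rw [if_pos hu, sub_self, termVal_zero]
    exact WithTop.coe_lt_top N
  · rw [if_neg hu, sub_zero]
    have : ((N + 1 : ℝ) : WithTop ℝ) ≤ termVal r (a.coeff u) u := by simpa using hu
    exact (WithTop.coe_lt_coe.mpr (lt_add_one N)).trans_le this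

lemma KXr.mul_mem_valGt {e h : KXr K r} {N v : ℝ} (he : e ∈ valGt r (N + 1 - v))
    (hv : h.valr = v) : e * h ∈ valGt r N := by
  have := coe_le_valr_mul (mem_valGt.mp he).le hv.symm.le
  rw [sub_add_cancel] at this
  exact (WithTop.coe_lt_coe.mpr (lt_add_one N)).trans_le this

/-- The coefficients of a combination are infinite series; truncating them far enough changes the
sum only by valuations greater than N and leaves finitely many term multiples. -/
lemma mem_closure_sup_of_mem_span {H : Finset (KXr K r)} {f : KXr K r}
    (hf : f ∈ Ideal.span (H : Set (KXr K r))) (N : ℝ) :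
    f ∈ AddSubgroup.closure {y | ∃ h ∈ H, ∃ c w, y = term r c w * h} ⊔ valGt r N := by
  obtain ⟨a, -, rfl⟩ := Submodule.mem_span_finset.mp hf
  refine sum_mem fun h hh => ?_
  by_cases h0 : h = 0
  · rw [h0, smul_zero]
    exact zero_mem _
  obtain ⟨v, hv⟩ := exists_valr_eq h0
  obtain ⟨F, hF⟩ := exists_sub_sum_term_mem_valGt (a h) (N + 1 - v)
  rw [smul_eq_mul, ← sub_add_cancel (a h) (∑ u ∈ F, term r ((a h).coeff u) u), add_mul,
    Finset.sum_mul]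
  refine add_mem (AddSubgroup.mem_sup_right (mul_mem_valGt hF hv)) (sum_mem fun u _ => ?_)
  exact AddSubgroup.mem_sup_left (AddSubgroup.subset_closure ⟨h, hh, _, _, rfl⟩)

variable [LinearOrder (Mon n)]

/-- The sums of multiples of elements of `H` with valuation in `E` and leading term satisfying
`Q`, up to terms of valuation greater than `N`. -/
noncomputable def levelSpan (H : Finset (KXr K r)) (E : Set ℝ) (N : ℝ) (Q : ℝ → Mon n → Prop) :
    AddSubgroup (KXr K r) :=
  AddSubgroup.closure {y | ∃ h ∈ H, ∃ c w, y = term r c w * h ∧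
    ∃ v ∈ E, ∃ m, HasLead y v m ∧ Q v m} ⊔ valGt r N

/-- Comparison of the levels `(v', m')` and `(v, m)`. -/
def LevelLE (v : ℝ) (m : Mon n) (v' : ℝ) (m' : Mon n) : Prop := v < v' ∨ v = v' ∧ m' ≤ m

/-- Strict comparison of the levels `(v', m')` and `(v, m)`. -/
def LevelLT (v : ℝ) (m : Mon n) (v' : ℝ) (m' : Mon n) : Prop := v < v' ∨ v = v' ∧ m' < m

lemma LevelLE.refl (v : ℝ) (m : Mon n) : LevelLE v m v m := Or.inr ⟨rfl, le_rfl⟩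

lemma LevelLE.trans {v₁ v₂ v₃ : ℝ} {m₁ m₂ m₃ : Mon n} (h : LevelLE v₁ m₁ v₂ m₂)
    (h' : LevelLE v₂ m₂ v₃ m₃) : LevelLE v₁ m₁ v₃ m₃ := by
  rcases h with h | ⟨rfl, h⟩
  · rcases h' with h' | ⟨rfl, -⟩
    · exact Or.inl (h.trans h')
    · exact Or.inl h
  · rcases h' with h' | ⟨rfl, h'⟩
    · exact Or.inl h'
    · exact Or.inr ⟨rfl, h'.trans h⟩

lemma LevelLE.total (v₁ v₂ : ℝ) (m₁ m₂ : Mon n) : LevelLE v₁ m₁ v₂ m₂ ∨ LevelLE v₂ m₂ v₁ m₁ := by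
  rcases lt_trichotomy v₁ v₂ with h | rfl | h
  · exact Or.inl (Or.inl h)
  · exact (le_total m₂ m₁).imp (fun h => Or.inr ⟨rfl, h⟩) fun h => Or.inr ⟨rfl, h⟩
  · exact Or.inr (Or.inl h)

variable {H : Finset (KXr K r)} {E : Set ℝ} {N : ℝ}

lemma levelSpan_mono {Q Q' : ℝ → Mon n → Prop} (h : ∀ v m, Q v m → Q' v m) :
    levelSpan H E N Q ≤ levelSpan H E N Q' :=
  fun _ => closure_sup_mono (by
    rintro _ ⟨p, hp, c, w, h1, v, hv, m, h2, h3⟩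
    exact ⟨p, hp, c, w, h1, v, hv, m, h2, h v m h3⟩)

/-- Membership in E matters only up to N: anything of larger valuation is absorbed by `valGt`. -/
lemma mem_levelSpan_of_hasLead {Q : ℝ → Mon n → Prop} {h : KXr K r} (hh : h ∈ H) {c : K}
    {w m : Mon n} {v : ℝ} (hl : HasLead (term r c w * h) v m) (hE : v ≤ N → v ∈ E) (hQ : Q v m) :
    term r c w * h ∈ levelSpan H E N Q := by
  by_cases hv : v ≤ N
  · exact AddSubgroup.mem_sup_left
      (AddSubgroup.subset_closure ⟨h, hh, c, w, rfl, v, hE hv, m, hl, hQ⟩)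
  · refine AddSubgroup.mem_sup_right ?_
    rw [mem_valGt, hl.valr_eq]
    exact WithTop.coe_lt_coe.mpr (not_le.mp hv)

/-- Only finitely many summands occur and levels are totally ordered, so one summand has the highest
level, unless everything is absorbed by `valGt`. -/
lemma levelSpan_cases {Q : ℝ → Mon n → Prop} {x : KXr K r} (hx : x ∈ levelSpan H E N Q) :
    x ∈ valGt r N ∨ ∃ v ∈ E, ∃ m, Q v m ∧ x ∈ levelSpan H E N (LevelLE v m) := by
  obtain ⟨a, ha, e, he, rfl⟩ := AddSubgroup.mem_sup.mp hx
  suffices a ∈ valGt r N ∨ ∃ v ∈ E, ∃ m, Q v m ∧ a ∈ levelSpan H E N (LevelLE v m) by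
    rcases this with h | ⟨v, hv, m, hQ, h⟩
    · exact Or.inl (add_mem h he)
    · exact Or.inr ⟨v, hv, m, hQ, add_mem h (AddSubgroup.mem_sup_right he)⟩
  clear hx
  induction ha using AddSubgroup.closure_induction with
  | mem y hy =>
    obtain ⟨p, hp, c, w, h1, v, hv, m, h2, h3⟩ := hy
    exact Or.inr ⟨v, hv, m, h3, AddSubgroup.mem_sup_left
      (AddSubgroup.subset_closure ⟨p, hp, c, w, h1, v, hv, m, h2, LevelLE.refl v m⟩)⟩
  | zero => exact Or.inl (zero_mem _)
  | add y z hy hz ihy ihz =>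
    rcases ihy with h1 | ⟨v, hv, m, hQ, h1⟩ <;>
      rcases ihz with h2 | ⟨v', hv', m', hQ', h2⟩
    · exact Or.inl (add_mem h1 h2)
    · exact Or.inr ⟨v', hv', m', hQ', add_mem (AddSubgroup.mem_sup_right h1) h2⟩
    · exact Or.inr ⟨v, hv, m, hQ, add_mem h1 (AddSubgroup.mem_sup_right h2)⟩
    · rcases LevelLE.total v v' m m' with h | h
      · exact Or.inr ⟨v, hv, m, hQ, add_mem h1 (levelSpan_mono (fun _ _ => h.trans) h2)⟩
      · exact Or.inr ⟨v', hv', m', hQ', add_mem (levelSpan_mono (fun _ _ => h.trans) h1) h2⟩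
  | neg y hy ih =>
    rcases ih with h | ⟨v, hv, m, hQ, h⟩
    · exact Or.inl (neg_mem h)
    · exact Or.inr ⟨v, hv, m, hQ, neg_mem h⟩

lemma levelSpan_le_below {v : ℝ} (hv : v ≤ N) (m : Mon n) :
    levelSpan H E N (LevelLT v m) ≤ below r v m := by
  refine sup_le ((AddSubgroup.closure_le _).mpr ?_) (valGt_le_below hv m)
  rintro y ⟨p, hp, c, w, -, v', -, m', h1, h2⟩
  exact h1.mem_below_iff.mpr h2

variable {I : Type*} {T : I → AddSubmonoid (Mon n)}

/-- A multiple of `h` with the leading monomial of a multiple of `h₀` is a multiple of the latter,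
up to smaller terms. -/
lemma exists_sub_mem_levelSpan (hT : IsConicDecomposition T) (hord : IsGMO T) {A : Set ℝ}
    {v₀ : ℝ} (hA : ∀ f ∈ H, ∀ g ∈ H, ∀ i, ∀ m ∈ leadSet T i f ∩ leadSet T i g,
      IsStandardIn T A (N - v₀) H i f g m)
    (hEA : ∀ e ∈ E, ∀ a ∈ A, e + a ≤ N → e + a ∈ E) {v : ℝ} (hvE : v ∈ E) (hv₀ : v₀ ≤ v)
    {m : Mon n} {h h₀ : KXr K r} (hh : h ∈ H) (hh₀ : h₀ ∈ H) {c c₀ : K} {w w₀ : Mon n}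
    (hl : HasLead (term r c w * h) v m) (hl₀ : HasLead (term r c₀ w₀ * h₀) v m) :
    ∃ c₁ : K, val c₀ ≤ val c₁ ∧
      term r c w * h - term r c₁ w₀ * h₀ ∈ levelSpan H E N (LevelLT v m) := by
  -- A cone containing m: there both lm_i are determined by m, and the S-pair at m involves exactly
  -- the shifts w and w₀.
  obtain ⟨i, hi⟩ := hT.exists_mem m
  have hm := hl.mem_leadSet hT hord hi
  have hm₀ := hl₀.mem_leadSet hT hord hi
  have hw := hl.lmCone_eq_sub hT hord hi
  have hw₀ := hl₀.lmCone_eq_sub hT hord hi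
  obtain ⟨hc, h0⟩ := hl.term_mul_ne
  obtain ⟨hc₀, h₀0⟩ := hl₀.term_mul_ne
  have hb := lcCone_ne_zero hT hord i h0
  have hb₀ := lcCone_ne_zero hT hord i h₀0
  have hlc := lcCone_eq hT hord i h0
  have hlc₀ := lcCone_eq hT hord i h₀0
  have hstd := hA h hh h₀ hh₀ i m ⟨hm, hm₀⟩
  have hsP : sPair T i h h₀ m = term r (lcCone T i h₀.initialForm) w * h -
      term r (lcCone T i h.initialForm) w₀ * h₀ := by
    rw [sPair, hw, hw₀, sub_sub_cancel, sub_sub_cancel]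
  obtain ⟨γ, hγ⟩ := exists_val_eq hc
  obtain ⟨γ₀, hγ₀⟩ := exists_val_eq hc₀
  obtain ⟨β, hβ⟩ := exists_val_eq hb
  obtain ⟨β₀, hβ₀⟩ := exists_val_eq hb₀
  have hL : sLevel T i h h₀ m = β + β₀ - dot r m := by
    rw [sLevel, hβ, hβ₀, WithTop.untopD_coe, WithTop.untopD_coe]
  have h1 := hl.coeffVal_eq
  have h2 := hl₀.coeffVal_eq
  rw [coeffVal, coeff_term_mul, ← hw, ← hlc, termVal, val_mul, hγ, hβ, ← WithTop.coe_add,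
    ← WithTop.coe_add, WithTop.coe_eq_coe] at h1
  rw [coeffVal, coeff_term_mul, ← hw₀, ← hlc₀, termVal, val_mul, hγ₀, hβ₀, ← WithTop.coe_add,
    ← WithTop.coe_add, WithTop.coe_eq_coe] at h2
  set b := lcCone T i h.initialForm
  set b₀ := lcCone T i h₀.initialForm
  have hd : val (c / b₀) = (γ - β₀ : ℝ) := by
    have := val_mul (c / b₀) b₀
    rw [div_mul_cancel₀ _ hb₀, hγ, hβ₀] at this
    refine WithTop.add_right_cancel (z := (β₀ : WithTop ℝ)) WithTop.coe_ne_top ?_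
    rw [← this, ← WithTop.coe_add, sub_add_cancel]
  have hd' : termVal r (c / b₀) 0 = (γ - β₀ : ℝ) := by simp [termVal, dot_zero, hd]
  -- This coefficient makes the leading coefficients agree, so the difference is c / b₀ times the
  -- S-pair. It has the valuation of c₀, since both multiples have level (v, m).
  refine ⟨c / b₀ * b, ?_, ?_⟩
  · rw [val_mul, hd, hβ, hγ₀, ← WithTop.coe_add, WithTop.coe_le_coe]
    linarith
  have heq : term r c w * h - term r (c / b₀ * b) w₀ * h₀ =
      term r (c / b₀) 0 * sPair T i h h₀ m := by
    rw [hsP, mul_sub, ← mul_assoc, ← mul_assoc, term_mul_term, term_mul_term, zero_add, zero_add,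
      div_mul_cancel₀ _ hb₀]
  have hδ : γ - β₀ + sLevel T i h h₀ m = v := by rw [hL]; linarith
  rw [heq]
  refine mul_mem_of_mem_closure_sup hstd ?_ fun e he => ?_
  · rintro y ⟨p, hp, c', w', rfl, hy, a, ha, hya⟩
    have hval : (term r (c / b₀) 0 * (term r c' w' * p)).valr = (v + a : ℝ) := by
      rw [valr_term_mul, hd', hya, ← WithTop.coe_add, ← hδ, add_assoc]
    have hbel := const_mul_mem_below hy hd.symm.le
    rw [hδ] at hbel
    rw [← mul_assoc, term_mul_term] at hval hbel ⊢
    have hl' := hasLead hval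
    exact mem_levelSpan_of_hasLead hp hl' (hEA v hvE a ha) (hl'.mem_below_iff.mp hbel)
  -- The truncation error has valuation greater than v + (N - v₀), which is at least N because v₀ ≤
  -- v.
  · refine AddSubgroup.mem_sup_right (valGt_anti ?_ (term_mul_mem_valGt hd' he))
    rw [← add_assoc, hδ]
    linarith

/-- Buchberger's criterion. -/
theorem lm_mem_leadSet_of_coneDone [Finite I] (hT : IsConicDecomposition T) (hord : IsGMO T)
    (hH : ∀ h ∈ H, h ≠ 0)
    (hdone : ∀ f ∈ H, ∀ g ∈ H, f ≠ g → (∀ i, ConeDone T H i f g) ∨ ∀ i, ConeDone T H i g f)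
    {f : KXr K r} (hf : f ∈ Ideal.span (H : Set (KXr K r))) (hf0 : f ≠ 0) :
    ∃ h ∈ H, ∃ i, lm f.initialForm ∈ leadSet T i h := by
  have := hT.wellFoundedLT hord
  obtain ⟨N, hN⟩ := exists_hasLead hf0
  have hfN : f ∉ valGt r N := fun h => (mem_valGt.mp h).ne' hN.valr_eq
  obtain ⟨y, hy, e, he, hye⟩ := AddSubgroup.mem_sup.mp (mem_closure_sup_of_mem_span hf N)
  obtain ⟨Y, hYS, hY, hyY⟩ := exists_finite_subset_mem_closure hy
  have hV : {v : ℝ | ∃ y ∈ Y, y.valr = v}.Finite := by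
    refine (hY.image fun y => y.valr.untopD 0).subset ?_
    rintro v ⟨y, hy, hv⟩
    exact ⟨y, hy, by simp only [hv, WithTop.untopD_coe]⟩
  obtain ⟨v₀, hv₀⟩ := hV.bddBelow
  obtain ⟨ϖ, hϖ, hstep⟩ := exists_val_step K
  obtain ⟨A, hA, hA0, hAH⟩ := exists_forall_isStandardIn hT hord hH hdone (N - v₀)
  obtain ⟨E', hE', hEN', hVE', hEA'⟩ := exists_finite_add_closed hV (hA.insert ϖ) (by
    rintro a (rfl | ha)
    exacts [hϖ.le, hA0 a ha]) N
  -- The cut at v₀ provides the lower bound on levels for which the truncation at N - v₀ was chosen;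
  -- nonnegative increments preserve it.
  obtain ⟨E, hE, hEN, hEv₀, hVE, hEA, hEϖ⟩ : ∃ E : Set ℝ, E.Finite ∧ (∀ e ∈ E, e ≤ N) ∧
      (∀ e ∈ E, v₀ ≤ e) ∧ (∀ y ∈ Y, ∀ v : ℝ, y.valr = v → v ≤ N → v ∈ E) ∧
      (∀ e ∈ E, ∀ a ∈ A, e + a ≤ N → e + a ∈ E) ∧ ∀ e ∈ E, e + ϖ ≤ N → e + ϖ ∈ E :=
    ⟨{e ∈ E' | v₀ ≤ e}, hE'.subset (Set.sep_subset _ _), fun e he => hEN' e he.1, fun e he => he.2,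
      fun y hy v hv hvN => ⟨hVE' v ⟨y, hy, hv⟩ hvN, hv₀ ⟨y, hy, hv⟩⟩,
      fun e he a ha h => ⟨hEA' e he.1 a (Set.mem_insert_of_mem _ ha) h, by
        have := he.2
        linarith [hA0 a ha]⟩,
      fun e he h => ⟨hEA' e he.1 ϖ (Set.mem_insert _ _) h, by
        have := he.2
        linarith⟩⟩
  have hfE : f ∈ levelSpan H E N fun _ _ => True := by
    rw [← hye]
    refine add_mem ?_ (AddSubgroup.mem_sup_right he)
    refine (AddSubgroup.closure_le _).mpr (fun z hz => ?_) hyY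
    by_cases h0 : z = 0
    · rw [h0]
      exact zero_mem _
    obtain ⟨p, hp, c, w, rfl⟩ := hYS hz
    obtain ⟨v, hv⟩ := exists_hasLead h0
    exact mem_levelSpan_of_hasLead hp hv (hVE _ hz v hv.valr_eq) trivial
  obtain ⟨v₁, hv₁, m₁, -, hf₁⟩ := (levelSpan_cases hfE).resolve_left hfN
  -- A representation of f of lowest possible highest level exists because E is finite and the
  -- monomials are well ordered.
  obtain ⟨⟨⟨v, hvE⟩, m⟩, hfμ, hmin⟩ := (wellFounded_level (α := Mon n) hE).has_min
    {p : E × Mon n | f ∈ levelSpan H E N (LevelLE p.1 p.2)} ⟨⟨⟨v₁, hv₁⟩, m₁⟩, hf₁⟩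
  have hflt : f ∉ levelSpan H E N (LevelLT v m) := by
    intro h
    obtain ⟨v', hv', m', hQ, h'⟩ := (levelSpan_cases h).resolve_left hfN
    exact hmin ⟨⟨v', hv'⟩, m'⟩ h' hQ
  -- If no multiple of an element of H had level (v, m), all summands would be strictly lower,
  -- against minimality.
  by_cases hex : ∃ h₀ ∈ H, ∃ c₀ w₀, HasLead (term r c₀ w₀ * h₀) v m
  swap
  · refine absurd ?_ hflt
    refine (sup_le ((AddSubgroup.closure_le _).mpr ?_) le_sup_right :
      levelSpan H E N (LevelLE v m) ≤ levelSpan H E N (LevelLT v m)) hfμ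
    rintro y ⟨p, hp, c, w, rfl, v', hv', m', h1, h2⟩
    refine mem_levelSpan_of_hasLead hp h1 (fun _ => hv') ?_
    rcases h2 with h2 | ⟨rfl, h2⟩
    · exact Or.inl h2
    · rcases h2.eq_or_lt with rfl | h2
      · exact absurd ⟨p, hp, c, w, h1⟩ hex
      · exact Or.inr ⟨rfl, h2⟩
  obtain ⟨h₀, hh₀, c₀, w₀, hl₀⟩ := hex
  obtain ⟨c, hc, hfc⟩ : ∃ c : K, val c₀ ≤ val c ∧
      f - term r c w₀ * h₀ ∈ levelSpan H E N (LevelLT v m) := by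
    -- All summands of level (v, m) merge into multiples of h₀ by the same monomial. The bound val
    -- c₀ ≤ val c, weaker than equality, is what survives addition of the coefficients.
    let D : AddSubgroup (KXr K r) :=
      { carrier := {x | ∃ c : K, val c₀ ≤ val c ∧
          x - term r c w₀ * h₀ ∈ levelSpan H E N (LevelLT v m)}
        zero_mem' := ⟨0, by rw [val_zero]; exact le_top, by
          rw [term_zero, zero_mul, sub_zero]; exact zero_mem _⟩
        add_mem' := by
          rintro x y ⟨c, hc, hx⟩ ⟨d, hd, hy⟩
          refine ⟨c + d, (le_min hc hd).trans (val_add c d), ?_⟩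
          rw [term_add, add_mul, add_sub_add_comm]
          exact add_mem hx hy
        neg_mem' := by
          rintro x ⟨c, hc, hx⟩
          refine ⟨-c, by rwa [val_neg], ?_⟩
          rw [term_neg, neg_mul, ← neg_sub_neg, neg_neg, neg_neg, ← neg_sub]
          exact neg_mem hx }
    have hD : levelSpan H E N (LevelLT v m) ≤ D := fun x hx =>
      ⟨0, by rw [val_zero]; exact le_top, by rwa [term_zero, zero_mul, sub_zero]⟩
    have : levelSpan H E N (LevelLE v m) ≤ D := by
      refine sup_le ((AddSubgroup.closure_le _).mpr ?_) (le_sup_right.trans hD)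
      rintro y ⟨p, hp, c, w, rfl, v', hv', m', h1, h2⟩
      rcases h2 with h2 | ⟨rfl, h2⟩
      · exact hD (mem_levelSpan_of_hasLead hp h1 (fun _ => hv') (Or.inl h2))
      · rcases h2.eq_or_lt with rfl | h2
        · exact exists_sub_mem_levelSpan hT hord hAH hEA hvE (hEv₀ _ hvE) hp hh₀ h1 hl₀
        · exact hD (mem_levelSpan_of_hasLead hp h1 (fun _ => hv') (Or.inr ⟨rfl, h2⟩))
    exact this hfμ
  obtain ⟨hc₀, hh₀0⟩ := hl₀.term_mul_ne
  by_cases hc0 : c = 0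
  · rw [hc0, term_zero, zero_mul, sub_zero] at hfc
    exact absurd hfc hflt
  obtain ⟨γ, hγ⟩ := exists_val_eq hc0
  obtain ⟨γ₀, hγ₀⟩ := exists_val_eq hc₀
  obtain ⟨k, hk⟩ := hstep c₀ c γ₀ γ hγ₀ hγ (by
    rw [hγ, hγ₀] at hc
    exact WithTop.coe_le_coe.mp hc)
  have hquot : val (c / c₀) = (k * ϖ : ℝ) := by
    have := val_mul (c / c₀) c₀
    rw [div_mul_cancel₀ _ hc₀, hγ, hγ₀] at this
    refine WithTop.add_right_cancel (z := (γ₀ : WithTop ℝ)) WithTop.coe_ne_top ?_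
    rw [← this, ← WithTop.coe_add, hk, add_comm]
  have hl := hl₀.const_mul hquot
  rw [← mul_assoc, term_mul_term, zero_add, div_mul_cancel₀ _ hc₀, add_comm] at hl
  -- If k = 0, the merged term keeps the level (v, m) and gives the leading monomial of f. If k > 0,
  -- cancellation has raised its valuation by k * ϖ, so it is strictly lower and contradicts
  -- minimality.
  rcases Nat.eq_zero_or_pos k with rfl | hkpos
  · rw [Nat.cast_zero, zero_mul, add_zero] at hl
    have hfl := hl.add_below (levelSpan_le_below (hEN v hvE) m hfc)
    rw [add_sub_cancel] at hfl
    obtain ⟨i, hi⟩ := hT.exists_mem m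
    exact ⟨h₀, hh₀, i, hfl.lm_eq.symm ▸ hl.mem_leadSet hT hord hi⟩
  · refine absurd ?_ hflt
    rw [← sub_add_cancel f (term r c w₀ * h₀)]
    refine add_mem hfc (mem_levelSpan_of_hasLead hh₀ hl (add_nat_mul_mem hϖ hEϖ hvE k) (Or.inl ?_))
    have : (0 : ℝ) < k * ϖ := by positivity
    linarith

end Criterion

end LaurentGB

namespace LaurentGB

open Filter Topology KXr
open scoped Pointwise

/-! ### Invariant, correctness and termination of the algorithm -/

section Buchberger

variable {K : Type*} [Field K] [CompleteDVField K] {n : ℕ} {r : Fin n → ℚ} {I : Type*}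
  {T : I → AddSubmonoid (Mon n)} [LinearOrder (Mon n)]

/-- The algorithm is treating the pair `(f, g)`. -/
def Phase.Treats {A I M : Type*} (f g : A) : Phase A I M → Prop
  | .outer => False
  | .cones f' g' _ => f' = f ∧ g' = g
  | .gens f' g' _ _ _ => f' = f ∧ g' = g

variable (T) in
/-- What holds inside the loops over the cones and over the generators. -/
def PhaseInvariant (H : Finset (KXr K r)) : Phase (KXr K r) I (Mon n) → Prop
  | .outer => True
  | .cones f g R => f ∈ H ∧ g ∈ H ∧ ∀ i ∉ R, ConeDone T H i f g
  | .gens f g i V R => f ∈ H ∧ g ∈ H ∧ (∀ j ∉ R, j ≠ i → ConeDone T H j f g) ∧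
      ∃ U, IsGeneratingSet T i f g U ∧ V ⊆ U ∧ ∀ v ∈ U, v ∉ V → IsStandard T H i f g v

variable (T) in
/-- The pair `(f, g)` is waiting, is being treated, or has been treated. -/
def Handled (S : BuchState (KXr K r) I (Mon n)) (f g : KXr K r) : Prop :=
  (f, g) ∈ S.pairs ∨ S.phase.Treats f g ∨ ∀ i, ConeDone T S.basis i f g

variable (T) in
/-- The invariant of Buchberger's algorithm for the ideal `J` and the input `h`. -/
structure BuchInvariant (J : Ideal (KXr K r)) {m : ℕ} (h : Fin m → KXr K r)
    (S : BuchState (KXr K r) I (Mon n)) : Prop where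
  ne_zero : ∀ g ∈ S.basis, g ≠ 0
  mem_ideal : ∀ g ∈ S.basis, g ∈ J
  input_mem : ∀ j, h j ∈ S.basis
  pairs_mem : ∀ f g, (f, g) ∈ S.pairs → f ∈ S.basis ∧ g ∈ S.basis
  phase : PhaseInvariant T S.basis S.phase
  handled : ∀ f ∈ S.basis, ∀ g ∈ S.basis, f ≠ g → Handled T S f g ∨ Handled T S g f

lemma BuchInvariant.init {m : ℕ} {h : Fin m → KXr K r} (h_ne : ∀ j, h j ≠ 0) :
    BuchInvariant T (Ideal.span (Set.range h)) h (BuchState.init I (Mon n) h) where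
  ne_zero g hg := by
    simp only [BuchState.init, Finset.mem_image, Finset.mem_univ, true_and] at hg
    obtain ⟨j, rfl⟩ := hg
    exact h_ne j
  mem_ideal g hg := by
    simp only [BuchState.init, Finset.mem_image, Finset.mem_univ, true_and] at hg
    exact Ideal.subset_span hg
  input_mem j := by simp [BuchState.init]
  pairs_mem f g hfg := by
    simp only [BuchState.init, Finset.mem_image, Finset.mem_filter, Prod.mk.injEq] at hfg ⊢
    obtain ⟨⟨j, k⟩, -, rfl, rfl⟩ := hfg
    simp
  phase := trivial
  handled f hf g hg hfg := by
    simp only [BuchState.init, Finset.mem_image, Finset.mem_univ, true_and] at hf hg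
    obtain ⟨j, rfl⟩ := hf
    obtain ⟨k, rfl⟩ := hg
    -- The input may contain repetitions. Distinct series have distinct indices, and their pair is
    -- stored in the order of the indices chosen here, so either order must be allowed.
    have hjk : j ≠ k := fun he => hfg (he ▸ rfl)
    refine hjk.lt_or_gt.imp (fun hlt => Or.inl ?_) fun hlt => Or.inl ?_ <;>
      simp only [BuchState.init, Finset.mem_image, Finset.mem_filter, Finset.mem_univ, true_and]
    · exact ⟨(j, k), hlt, rfl⟩
    · exact ⟨(k, j), hlt, rfl⟩

lemma BuchInvariant.step [Fintype I] (hT : IsConicDecomposition T) (hord : IsGMO T)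
    {J : Ideal (KXr K r)} {m : ℕ} {h : Fin m → KXr K r} {S S' : BuchState (KXr K r) I (Mon n)}
    (hS : BuchInvariant T J h S) (hstep : BuchStep T S S') : BuchInvariant T J h S' := by
  classical
  obtain ⟨hne, hJ, hin, hpairs, hph, hh⟩ := hS
  cases hstep with
  | selectPair H B f g hfg =>
    refine ⟨hne, hJ, hin, fun f' g' h' => hpairs f' g' (Finset.mem_of_mem_erase h'),
      ⟨(hpairs f g hfg).1, (hpairs f g hfg).2, fun i hi => absurd (Finset.mem_univ i) hi⟩, ?_⟩
    have key : ∀ f' g', Handled T ⟨H, B, .outer⟩ f' g' →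
        Handled T ⟨H, B.erase (f, g), .cones f g Finset.univ⟩ f' g' := by
      rintro f' g' (h' | h' | h')
      · by_cases he : (f', g') = (f, g)
        · obtain ⟨rfl, rfl⟩ := Prod.mk.inj he
          exact Or.inr (Or.inl ⟨rfl, rfl⟩)
        · exact Or.inl (Finset.mem_erase.mpr ⟨he, h'⟩)
      · exact h'.elim
      · exact Or.inr (Or.inr h')
    exact fun f' hf' g' hg' he => (hh f' hf' g' hg' he).imp (key _ _) (key _ _)
  | selectCone H B f g R i U hi hU =>
    obtain ⟨hf, hg, hR⟩ := hph
    exact ⟨hne, hJ, hin, hpairs, ⟨hf, hg, fun j hj hji =>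
      hR j fun hjR => hj (Finset.mem_erase.mpr ⟨hji, hjR⟩), U, hU, Finset.Subset.refl U,
      fun v hv hv' => absurd hv hv'⟩, hh⟩
  | divideZero H B f g i V R v hv hrem =>
    obtain ⟨hf, hg, hR, U, hU, hVU, hstd⟩ := hph
    refine ⟨hne, hJ, hin, hpairs, ⟨hf, hg, hR, U, hU, (Finset.erase_subset _ _).trans hVU, ?_⟩, hh⟩
    intro u hu huV
    by_cases huv : u = v
    · subst huv
      exact hrem.isStandard_zero hT hord hne (hne f hf) (hne g hg) (hU.subset (hVU hv))
    · exact hstd u hu fun h' => huV (Finset.mem_erase.mpr ⟨huv, h'⟩)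
  | divideNonzero H B f g i V R v s hv hrem hs =>
    obtain ⟨hf, hg, hR, U, hU, hVU, hstd⟩ := hph
    have hsub : H ⊆ insert s H := Finset.subset_insert s H
    have hsJ : s ∈ J := by
      have h1 : sPair T i f g v ∈ J :=
        J.sub_mem (J.mul_mem_left _ (hJ f hf)) (J.mul_mem_left _ (hJ g hg))
      have := J.sub_mem h1 (hrem.sub_mem hT hord hne hJ)
      rwa [sub_sub_cancel] at this
    refine ⟨fun p hp => ?_, fun p hp => ?_, fun j => hsub (hin j), fun f' g' h' => ?_,
      ⟨hsub hf, hsub hg, fun j hj hji => (hR j hj hji).mono hsub, U, hU,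
        (Finset.erase_subset _ _).trans hVU, fun u hu huV => ?_⟩, fun f' hf' g' hg' he => ?_⟩
    · rcases Finset.mem_insert.mp hp with rfl | hp
      exacts [hs, hne p hp]
    · rcases Finset.mem_insert.mp hp with rfl | hp
      exacts [hsJ, hJ p hp]
    · rcases Finset.mem_union.mp h' with h' | h'
      · exact (hpairs f' g' h').imp (fun a => hsub a) fun a => hsub a
      · obtain ⟨p, hp, hpe⟩ := Finset.mem_image.mp h'
        obtain ⟨rfl, rfl⟩ := Prod.mk.inj hpe
        exact ⟨hsub hp, Finset.mem_insert_self _ _⟩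
    · by_cases huv : u = v
      · subst huv
        exact hrem.isStandard_insert hT hord hne (hne f hf) (hne g hg) (hU.subset (hVU hv))
      · exact (hstd u hu fun h' => huV (Finset.mem_erase.mpr ⟨huv, h'⟩)).mono hsub
    -- Standard representations survive enlargement of the basis, so old pairs remain handled; each
    -- pair formed with the new element s has just been added.
    · have key : ∀ f' g', Handled T ⟨H, B, .gens f g i V R⟩ f' g' → Handled T
          ⟨insert s H, B ∪ H.image (fun h => (h, s)), .gens f g i (V.erase v) R⟩ f' g' := by
        rintro f' g' (h' | h' | h')
        · exact Or.inl (Finset.mem_union_left _ h')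
        · exact Or.inr (Or.inl h')
        · exact Or.inr (Or.inr fun j => (h' j).mono hsub)
      rcases Finset.mem_insert.mp hf' with rfl | hf₁ <;>
        rcases Finset.mem_insert.mp hg' with rfl | hg₁
      · exact absurd rfl he
      · exact Or.inr (Or.inl (Finset.mem_union_right _ (Finset.mem_image.mpr ⟨g', hg₁, rfl⟩)))
      · exact Or.inl (Or.inl (Finset.mem_union_right _ (Finset.mem_image.mpr ⟨f', hf₁, rfl⟩)))
      · exact (hh f' hf₁ g' hg₁ he).imp (key _ _) (key _ _)
  | endGens H B f g i R =>
    obtain ⟨hf, hg, hR, U, hU, hVU, hstd⟩ := hph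
    refine ⟨hne, hJ, hin, hpairs, ⟨hf, hg, fun j hj => ?_⟩, hh⟩
    by_cases hji : j = i
    · exact hji ▸ ⟨U, hU, fun v hv => hstd v hv (Finset.notMem_empty v)⟩
    · exact hR j hj hji
  | endCones H B f g =>
    obtain ⟨hf, hg, hR⟩ := hph
    refine ⟨hne, hJ, hin, hpairs, trivial, ?_⟩
    have key : ∀ f' g', Handled T ⟨H, B, .cones f g ∅⟩ f' g' →
        Handled T ⟨H, B, .outer⟩ f' g' := by
      rintro f' g' (h' | ⟨rfl, rfl⟩ | h')
      · exact Or.inl h'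
      · exact Or.inr (Or.inr fun i => hR i (Finset.notMem_empty i))
      · exact Or.inr (Or.inr h')
    exact fun f' hf' g' hg' he => (hh f' hf' g' hg' he).imp (key _ _) (key _ _)

/-- The output is a Gröbner basis. -/
lemma BuchInvariant.isGroebnerBasis [Finite I] (hT : IsConicDecomposition T) (hord : IsGMO T)
    {m : ℕ} {h : Fin m → KXr K r} {S : BuchState (KXr K r) I (Mon n)}
    (hS : BuchInvariant T (Ideal.span (Set.range h)) h S) (hfin : S.IsFinal) :
    IsGroebnerBasis T (Ideal.span (Set.range h)) S.basis := by
  refine ⟨hS.mem_ideal, hS.ne_zero, Set.Subset.antisymm ?_ ?_⟩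
  · rintro w ⟨f, hf, hf0, rfl⟩
    -- At the end no pair is waiting or being treated, so each pair of distinct elements has been
    -- treated in one of the two orders.
    have hdone : ∀ f g, Handled T S f g → ∀ i, ConeDone T S.basis i f g := by
      rintro f g (h' | h' | h')
      · rw [hfin.2] at h'
        exact absurd h' (Finset.notMem_empty _)
      · rw [hfin.1] at h'
        exact h'.elim
      · exact h'
    have hspan : f ∈ Ideal.span (S.basis : Set (KXr K r)) := by
      refine Ideal.span_mono ?_ hf
      rintro _ ⟨j, rfl⟩
      exact hS.input_mem j
    obtain ⟨g, hg, i, hi⟩ := lm_mem_leadSet_of_coneDone hT hord hS.ne_zero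
      (fun f hf g hg he => (hS.handled f hf g hg he).imp (hdone _ _) (hdone _ _)) hspan hf0
    exact Set.mem_iUnion₂.mpr ⟨g, hg, Set.mem_iUnion.mpr ⟨i, hi⟩⟩
  · intro w hw
    obtain ⟨g, hg, hw⟩ := Set.mem_iUnion₂.mp hw
    obtain ⟨t, rfl⟩ := (mem_iUnion_leadSet_iff hT hord (hS.ne_zero g hg)).mp hw
    exact ⟨_, Ideal.mul_mem_left _ _ (hS.mem_ideal g hg),
      term_mul_ne_zero one_ne_zero t (hS.ne_zero g hg), rfl⟩

/-- The algorithm does not get stuck. -/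
lemma BuchInvariant.exists_step [Fintype I] (hT : IsConicDecomposition T) (hord : IsGMO T)
    {J : Ideal (KXr K r)} {m : ℕ} {h : Fin m → KXr K r} {S : BuchState (KXr K r) I (Mon n)}
    (hS : BuchInvariant T J h S) (hfin : ¬ S.IsFinal) : ∃ S', BuchStep T S S' := by
  obtain ⟨H, B, phase⟩ := S
  have hne := hS.ne_zero
  have hph := hS.phase
  cases phase with
  | outer =>
    obtain ⟨⟨f, g⟩, hfg⟩ := Finset.nonempty_iff_ne_empty.mpr fun h' : B = ∅ => hfin ⟨rfl, h'⟩
    exact ⟨_, .selectPair H B f g hfg⟩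
  | cones f g R =>
    rcases R.eq_empty_or_nonempty with rfl | ⟨i, hi⟩
    · exact ⟨_, .endCones H B f g⟩
    · obtain ⟨U, hU⟩ := exists_isGeneratingSet hT hord i (hne f hph.1) (hne g hph.2.1)
      exact ⟨_, .selectCone H B f g R i U hi hU⟩
  | gens f g i V R =>
    rcases V.eq_empty_or_nonempty with rfl | ⟨v, hv⟩
    · exact ⟨_, .endGens H B f g i R⟩
    · obtain ⟨s, hs⟩ := exists_isRemainder hT hord hne (sPair T i f g v)
      by_cases h0 : s = 0
      · exact ⟨_, .divideZero H B f g i V R v hv (h0 ▸ hs)⟩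
      · exact ⟨_, .divideNonzero H B f g i V R v s hv hs h0⟩

/-- The number of pairs left, then the progress in the loops. -/
def buchMeasure {A I M : Type*} (S : BuchState A I M) : ℕ ×ₗ ℕ ×ₗ ℕ :=
  -- The weights make the loops decrease: entering a cone turns 2|R| + 1 into 2(|R| - 1) + 2,
  -- leaving it turns 2|R| + 2 into 2|R| + 1, and leaving the last loop turns 1 into 0.
  toLex (S.pairs.card, match S.phase with
    | .outer => toLex (0, 0)
    | .cones _ _ R => toLex (2 * R.card + 1, 0)
    | .gens _ _ _ V R => toLex (2 * R.card + 2, V.card))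

/-- Each step enlarges the leading sets or makes progress with an unchanged basis. -/
lemma BuchInvariant.basis_or_measure [Fintype I] (hT : IsConicDecomposition T) (hord : IsGMO T)
    {J : Ideal (KXr K r)} {m : ℕ} {h : Fin m → KXr K r} {S S' : BuchState (KXr K r) I (Mon n)}
    (hS : BuchInvariant T J h S) (hstep : BuchStep T S S') : S.basis ⊆ S'.basis ∧
      ((∃ s ∈ S'.basis, s ≠ 0 ∧ ∀ i, ∀ g ∈ S.basis, lm s.initialForm ∉ leadSet T i g) ∨
        buchMeasure S' < buchMeasure S) := by
  classical
  have hne := hS.ne_zero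
  cases hstep with
  | selectPair H B f g hfg =>
    refine ⟨Finset.Subset.refl _, Or.inr (Prod.Lex.toLex_lt_toLex.mpr (Or.inl ?_))⟩
    exact Finset.card_erase_lt_of_mem hfg
  | selectCone H B f g R i U hi hU =>
    refine ⟨Finset.Subset.refl _, Or.inr (Prod.Lex.toLex_lt_toLex.mpr (Or.inr ⟨rfl,
      Prod.Lex.toLex_lt_toLex.mpr (Or.inl ?_)⟩))⟩
    have := Finset.card_erase_lt_of_mem hi
    show 2 * (R.erase i).card + 2 < 2 * R.card + 1
    omega
  | divideZero H B f g i V R v hv hrem =>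
    refine ⟨Finset.Subset.refl _, Or.inr (Prod.Lex.toLex_lt_toLex.mpr (Or.inr ⟨rfl,
      Prod.Lex.toLex_lt_toLex.mpr (Or.inr ⟨rfl, ?_⟩)⟩))⟩
    exact Finset.card_erase_lt_of_mem hv
  | divideNonzero H B f g i V R v s hv hrem hs =>
    refine ⟨Finset.subset_insert s H, Or.inl ⟨s, Finset.mem_insert_self _ _, hs, fun j p hp => ?_⟩⟩
    obtain ⟨b, hb⟩ := exists_hasLead hs
    exact hrem.notMem_leadSet hT hord hne hb.coeff_ne_zero j hp
  | endGens H B f g i R =>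
    refine ⟨Finset.Subset.refl _, Or.inr (Prod.Lex.toLex_lt_toLex.mpr (Or.inr ⟨rfl,
      Prod.Lex.toLex_lt_toLex.mpr (Or.inl ?_)⟩))⟩
    exact Nat.lt_succ_self _
  | endCones H B f g =>
    refine ⟨Finset.Subset.refl _, Or.inr (Prod.Lex.toLex_lt_toLex.mpr (Or.inr ⟨rfl,
      Prod.Lex.toLex_lt_toLex.mpr (Or.inl ?_)⟩))⟩
    exact Nat.succ_pos _

/-- There is no infinite run. -/
lemma not_exists_infinite_run [Fintype I] (hT : IsConicDecomposition T) (hord : IsGMO T)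
    {J : Ideal (KXr K r)} {m : ℕ} {h : Fin m → KXr K r} {σ : ℕ → BuchState (KXr K r) I (Mon n)}
    (hσ : ∀ k, BuchInvariant T J h (σ k)) (hstep : ∀ k, BuchStep T (σ k) (σ (k + 1))) : False := by
  have hprog := fun k => (hσ k).basis_or_measure hT hord (hstep k)
  have hmono : Monotone fun k => (σ k).basis := monotone_nat_of_le_succ fun k => (hprog k).1
  -- Either leading sets grow infinitely often, against Dickson's lemma, or from some step on the
  -- measure decreases forever.
  by_cases hfreq : ∃ᶠ k in atTop, ∃ s ∈ (σ (k + 1)).basis, s ≠ 0 ∧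
      ∀ i, ∀ g ∈ (σ k).basis, lm s.initialForm ∉ leadSet T i g
  · obtain ⟨φ, hφ, hs⟩ := extraction_of_frequently_atTop hfreq
    choose s hsmem hs0 hlm using hs
    obtain ⟨j, k, i, hjk, hi, t, ht, hadd⟩ := hT.exists_lt_add_eq fun k => lm (s k).initialForm
    -- As φ j + 1 ≤ φ k, the earlier remainder s j is already in the basis when s k is computed.
    refine hlm k i (s j) (hmono (Nat.succ_le_of_lt (hφ hjk)) (hsmem j)) ?_
    rw [← hadd]
    -- The trivial shift 0 puts the leading monomial of s j in its own leading set, since that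
    -- monomial lies in T i; its translate by t follows.
    refine add_mem_leadSet hT hord (hs0 j) ht ((mem_leadSet_iff hT hord (hs0 j)).mpr ⟨hi, 0, ?_⟩)
    rw [← one_def, one_mul]
  · obtain ⟨k₀, hk₀⟩ := eventually_atTop.mp (not_frequently.mp hfreq)
    refine (wellFounded_iff_isEmpty_descending_chain.mp
      (wellFounded_lt (α := ℕ ×ₗ ℕ ×ₗ ℕ))).false ⟨fun k => buchMeasure (σ (k₀ + k)), fun k => ?_⟩
    exact (hprog (k₀ + k)).2.resolve_left (hk₀ _ (Nat.le_add_right _ _))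

end Buchberger

end LaurentGB

theorem mainTheorem5 {K : Type*} [Field K] [CompleteDVField K] {n : ℕ} (hn : 0 < n)
    (r : Fin n → ℚ) {I : Type*} [Fintype I] (T : I → AddSubmonoid (Mon n))
    (hT : IsConicDecomposition T) [LinearOrder (Mon n)] (hord : IsGMO T)
    {m : ℕ} (h : Fin m → KXr K r) (h_ne : ∀ j, h j ≠ 0) :
    -- no run is infinite
    (¬ ∃ σ : ℕ → BuchState (KXr K r) I (Mon n),
      σ 0 = BuchState.init I (Mon n) h ∧ ∀ k, BuchStep T (σ k) (σ (k + 1))) ∧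
    ∀ S : BuchState (KXr K r) I (Mon n),
      Relation.ReflTransGen (BuchStep T) (BuchState.init I (Mon n) h) S →
        -- the output is a Gröbner basis
        (S.IsFinal → IsGroebnerBasis T (Ideal.span (Set.range h)) S.basis) ∧
        -- the algorithm never gets stuck before it returns
        (¬ S.IsFinal → ∃ S', BuchStep T S S') ∧
        -- each call to the division converges
        (∀ p, CallsDivision T S p → ∀ σ, IsDivRun T p S.basis σ → ∃ q s, DivRunOutputs σ q s) := by
  constructor
  · rintro ⟨σ, h0, hstep⟩
    have hσ : ∀ k, BuchInvariant T (Ideal.span (Set.range h)) h (σ k) := by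
      intro k
      induction k with
      | zero => exact h0 ▸ BuchInvariant.init h_ne
      | succ k ih => exact ih.step hT hord (hstep k)
    exact not_exists_infinite_run hT hord hσ hstep
  · intro S hS
    have hinv : BuchInvariant T (Ideal.span (Set.range h)) h S := by
      induction hS with
      | refl => exact BuchInvariant.init h_ne
      | tail _ hstep ih => exact ih.step hT hord hstep
    exact ⟨hinv.isGroebnerBasis hT hord, hinv.exists_step hT hord,
      fun _ _ _ hσ => hσ.exists_outputs hT hord hinv.ne_zero⟩
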